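/- **Conventions.** Fix $k\ge 1$. Deterministic algorithms that generate strings (programs and generators) are $k$-tape Turing machines with an arbitrary finite tape alphabet; the input is written on the first tape, and the output is the string found at the beginning of the first tape on halting. Fix a universal machine $U$ for these machines: every program $\Pi\in\{0,1\}^*$ is either invalid or encodes a pair $(M,w)$ of a $k$-tape machine and an input $w\in\{0,1\}^*$, every pair is encoded, and for each $M$ there is a constant $c_M$ such that every $(M,w)$ has an encoding of length at most $|w|+c_M$. Write $U(\Pi,1^s)=x$ if $\Pi$ encodes $(M,w)$ and $M(w)$ halts within $s$ steps with output $x$. For $t:\mathbb N\to[0,\infty)$ let $K^t(x)=\min\{|\Pi| : U(\Pi,1^{\lfloor t(|x|)\rfloor})=x\}$. A PPT algorithm is a probabilistic polynomial-time Turing machine (with any number of tapes) that tosses fair coins. All logarithms are to base $2$, $\mathcal U_n$ is the uniform distribution on $\{0,1\}^n$, $H$ is Shannon entropy, and "$n+\gamma\log n$" as a length means $n+\lfloor\gamma\log n\rfloor$. **Definitions.** Ensembles $\{A_n\},\{B_n\}$ are *$\mu$-indistinguishable* if for every probabilistic machine $D$ whose running time is polynomial in the length of its first input, $|\Pr[D(1^n,A_n)=1]-\Pr[D(1^n,B_n)=1]|<\mu(n)$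 for all sufficiently large $n$. A polynomial-time computable function $G:\{0,1\}^n\to\{0,1\}^{n+\gamma\log n}$ (for all $n$) is a *$\mu$-conditionally secure entropy-preserving PRG ($\mu$-condEP-PRG)* if there are non-empty events $E_n\subseteq\{0,1\}^n$ and a constant $\alpha$ such that $\{G(\mathcal U_n\mid E_n)\}_n$ and $\{\mathcal U_{n+\gamma\log n}\}_n$ are $\mu$-indistinguishable and $H(G(\mathcal U_n\mid E_n))\ge n-\alpha\log n$ for all sufficiently large $n$. It is *rate-1 efficient* if it is computed by a $k$-tape machine whose running time on inputs of length $n$ is at most $n+O(n^{a})$ for some constant $a<1$. A function $f:\{0,1\}^*\to\mathbb N$ is *mildly hard-on-average to $\beta(\cdot)$-approximate* if there is a polynomial $p>0$ such that for every PPT algorithm $\mathcal H$ and all sufficiently large $n$, $$\Pr\big[x\leftarrow\{0,1\}^n:\ |\mathcal H(x)-f(x)|\le\beta(n)\big]<1-\frac1{p(n)},$$ where the probability is also over the coins of $\mathcal H$ and the output of $\mathcal H$ is read as a number in binary. **Theorem.** Suppose that for every rational $\gamma>1$ there is a rate-1 efficient $\mu$-condEP-PRG $G:\{0,1\}^n\to\{0,1\}^{n+\gamma\log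 n}$ with $\mu(n)=1/n^2$. Then for all constants $d>0$, $\varepsilon>0$ and every polynomial $t$ (with real coefficients) such that $t(n)\ge(1+\varepsilon)n$ for all $n\in\mathbb N$, the function $K^t$ is mildly hard-on-average to $(d\log n)$-approximate. -/

import Mathlib

namespace CondEP

/-! ### Turing machines -/

/-- Head moves. Tapes are infinite to the right only; a left move in cell `0` leaves the head there. -/
inductive Move where
  | left : Move
  | stay : Move
  | right : Move

def Move.apply : Move → ℕ → ℕ
  | .left, i => i - 1
  | .stay, i => i
  | .right, i => i + 1

/-- Tape symbols: the blank `none`, the two bits, and `g` auxiliary symbols. -/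
abbrev Sym (g : ℕ) : Type := Option (Bool ⊕ Fin g)

/-- A Turing machine with `k + 1` tapes (tape `0` holds the input and the output, the others are
work tapes). The states are `0, …, q`, where `0` is initial and `q` is halting. In each step the
machine receives an element of `C`: deterministic machines have `C = Unit`, and probabilistic
machines, which toss one fair coin per step, have `C = Bool`. -/
structure TM (C : Type) (k : ℕ) where
  q : ℕ
  g : ℕ
  δ : Fin (q + 1) → C → (Fin (k + 1) → Sym g) → Fin (q + 1) × (Fin (k + 1) → Sym g × Move)

namespace TM

variable {C : Type} {k : ℕ}

structure Cfg (M : TM C k) where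
  state : Fin (M.q + 1)
  tape : Fin (k + 1) → ℕ → Sym M.g
  head : Fin (k + 1) → ℕ

/-- The initial configuration: `x` stands in the first cells of tape `0`, everything else is blank,
and all heads are in cell `0`. -/
def init (M : TM C k) (x : List Bool) : M.Cfg where
  state := 0
  tape i j := if i = 0 then (x[j]?).map Sum.inl else none
  head _ := 0

def Cfg.Halted {M : TM C k} (s : M.Cfg) : Prop := s.state = Fin.last M.q

/-- One step of the computation; a halted configuration does not change any more. -/
def step (M : TM C k) (c : C) (s : M.Cfg) : M.Cfg :=
  if s.state = Fin.last M.q then s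
  else
    let a := M.δ s.state c (fun i => s.tape i (s.head i))
    { state := a.1
      tape := fun i => Function.update (s.tape i) (s.head i) (a.2 i).1
      head := fun i => (a.2 i).2.apply (s.head i) }

/-- The configuration reached from the input `x` after `t` steps, where the `i`-th step receives
`ρ i`. -/
def run (M : TM C k) (ρ : ℕ → C) (x : List Bool) : ℕ → M.Cfg
  | 0 => M.init x
  | t + 1 => M.step (ρ t) (M.run ρ x t)

/-- The bit written in a cell, if there is one. -/
def bitOf {g : ℕ} : Sym g → Option Bool
  | some (Sum.inl b) => some b
  | _ => none

/-- `y` is the string of bits written on tape `0` from cell `0` up to the first cell that does not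
contain a bit. -/
def Cfg.Reads {M : TM C k} (s : M.Cfg) (y : List Bool) : Prop :=
  ∀ i ≤ y.length, bitOf (s.tape 0 i) = y[i]?

/-- On input `x` (and with `ρ` fed to the steps) the machine halts within `t` steps and its output
is `y`. -/
def Outputs (M : TM C k) (ρ : ℕ → C) (x : List Bool) (t : ℕ) (y : List Bool) : Prop :=
  (M.run ρ x t).Halted ∧ (M.run ρ x t).Reads y

/-- The deterministic machine `M` outputs `y` on input `x` within `t` steps. -/
def Computes (M : TM Unit k) (x : List Bool) (t : ℕ) (y : List Bool) : Prop :=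
  M.Outputs (fun _ => ()) x t y

end TM

/-! ### Time-bounded Kolmogorov complexity -/

/-- How a universal machine `U` reads its programs: a program `p` is an encoding of a pair `(M, w)`
of a `(k + 1)`-tape machine and an input (or is invalid). Every pair has an encoding, whose
length exceeds `|w|` only by a constant that depends on `M`. -/
structure DescriptionSystem (k : ℕ) where
  decode : List Bool → Option (TM Unit k × List Bool)
  universal : ∀ M : TM Unit k, ∃ c : ℕ, ∀ w : List Bool, ∃ p : List Bool,
    decode p = some (M, w) ∧ p.length ≤ w.length + c

/-- `U(p, 1^t) = x`: the program `p` encodes a pair `(M, w)`, and `M(w)`, emulated for `t` steps,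
outputs `x`. -/
def DescriptionSystem.Emulates {k : ℕ} (U : DescriptionSystem k) (p : List Bool) (t : ℕ)
    (x : List Bool) : Prop :=
  ∃ (M : TM Unit k) (w : List Bool), U.decode p = some (M, w) ∧ M.Computes w t x

/-- `K^t(x)`, the least length of a program `p` with `U(p, 1^{t(|x|)}) = x`. -/
noncomputable def DescriptionSystem.K {k : ℕ} (U : DescriptionSystem k) (t : ℕ → ℕ)
    (x : List Bool) : ℕ :=
  sInf {l : ℕ | ∃ p : List Bool, p.length = l ∧ U.Emulates p (t x.length) x}

/-- The minimum in the definition of `K^t` is attained for every `t` and `x`: the machine that halts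
at once outputs its input. -/
theorem DescriptionSystem.K_attained {k : ℕ} (U : DescriptionSystem k) (t : ℕ → ℕ)
    (x : List Bool) :
    ∃ p : List Bool, p.length = U.K t x ∧ U.Emulates p (t x.length) x := by
  have hne : {l : ℕ | ∃ p : List Bool, p.length = l ∧ U.Emulates p (t x.length) x}.Nonempty := by
    let M : TM Unit k := ⟨0, 0, fun _ _ _ => (0, fun _ => (none, .stay))⟩
    obtain ⟨c, hc⟩ := U.universal M
    obtain ⟨p, hp, -⟩ := hc x
    have hrun : ∀ n, M.run (fun _ => ()) x n = M.init x := by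
      intro n
      induction n with
      | zero => rfl
      | succ n ih =>
        simp only [TM.run, ih, TM.step]
        exact if_pos (Subsingleton.elim (α := Fin 1) _ _)
    refine ⟨_, p, rfl, M, x, hp, ?_, ?_⟩
    · exact Subsingleton.elim (α := Fin 1) _ _
    · intro i _
      rw [hrun]
      simp only [TM.init, if_true]
      cases x[i]? <;> rfl
  exact Nat.sInf_mem hne

instance : Encodable Move :=
  Encodable.ofLeftInjection
    (fun m : Move => match m with | .left => (0 : ℕ) | .stay => 1 | .right => 2)
    (fun n => match n with | 0 => some .left | 1 => some .stay | _ => some .right)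
    (fun m => by cases m <;> rfl)

/-- An effective enumeration of the deterministic machines, through their transition tables. -/
instance (k : ℕ) : Encodable (TM Unit k) :=
  letI (g : ℕ) : Fintype (Fin (k + 1) → Sym g) := Pi.instFintype
  letI (g : ℕ) : Encodable (Fin (k + 1) → Sym g) := Encodable.finArrow
  letI (q g : ℕ) : Encodable ((Fin (k + 1) → Sym g) →
      Fin (q + 1) × (Fin (k + 1) → Sym g × Move)) := Encodable.fintypeArrowOfEncodable
  Encodable.ofLeftInjection
    (α := Σ q : ℕ, Σ g : ℕ, Fin (q + 1) → (Fin (k + 1) → Sym g) →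
      Fin (q + 1) × (Fin (k + 1) → Sym g × Move))
    (fun M => ⟨M.q, M.g, fun i => M.δ i ()⟩) (fun s => some ⟨s.1, s.2.1, fun i _ => s.2.2 i⟩)
    (fun _ => rfl)

/-- The textbook description system, in which `1^i 0 w` encodes the `i`-th machine together with the
input `w`. -/
def DescriptionSystem.standard (k : ℕ) : DescriptionSystem k where
  decode p :=
    (Encodable.decode (p.takeWhile id).length).map
      fun M => (M, (p.dropWhile id).tail)
  universal M := by
    refine ⟨Encodable.encode M + 1, fun w =>
      ⟨List.replicate (Encodable.encode M) true ++ false :: w, ?_, ?_⟩⟩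
    · have h1 : ∀ n : ℕ, (List.replicate n true ++ false :: w).takeWhile id
          = List.replicate n true := by
        intro n; induction n with
        | zero => rfl
        | succ n ih => simp [List.replicate_succ, ih]
      have h2 : ∀ n : ℕ, (List.replicate n true ++ false :: w).dropWhile id = false :: w := by
        intro n; induction n with
        | zero => rfl
        | succ n ih => simp [List.replicate_succ, ih]
      simp [h1, h2]
    · simp; omega

/-! ### Probabilistic polynomial time and average-case hardness -/

/-- The probability of an event over `T` independent fair coins; only the first `T` entries of the
sequence passed to `P` are random. -/
noncomputable def coinProb (T : ℕ) (P : (ℕ → Bool) → Prop) : ℝ :=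
  (Nat.card {r : Fin T → Bool // P (fun i => if h : i < T then r ⟨i, h⟩ else false)} : ℝ) / 2 ^ T

/-- The number that a bit string denotes in binary, least significant bit first. -/
def binVal (y : List Bool) : ℕ := Nat.ofDigits 2 (y.map Bool.toNat)

/-- For all coin tosses, `H` halts on every input `x` within `T(|x|)` steps. -/
def RunsInTime {k : ℕ} (H : TM Bool k) (T : Polynomial ℕ) : Prop :=
  ∀ (x : List Bool) (ρ : ℕ → Bool), (H.run ρ x (T.eval x.length)).Halted

/-- The probability, over uniform `x ∈ {0,1}^n` and the coins of `H`, that `|H(x) - f(x)| ≤ b`. -/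
noncomputable def approxProb {k : ℕ} (H : TM Bool k) (T : Polynomial ℕ) (f : List Bool → ℕ)
    (b : ℝ) (n : ℕ) : ℝ :=
  (∑ x : Fin n → Bool, coinProb (T.eval n) (fun ρ => ∃ y : List Bool,
      H.Outputs ρ (List.ofFn x) (T.eval n) y ∧
        |(binVal y : ℝ) - (f (List.ofFn x) : ℝ)| ≤ b)) / 2 ^ n

/-- `f` is `α`-hard-on-average to `β`-approximate. -/
def HoAToApprox (f : List Bool → ℕ) (α β : ℕ → ℝ) : Prop :=
  ∀ (k : ℕ) (H : TM Bool k) (T : Polynomial ℕ), RunsInTime H T →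
    ∃ N : ℕ, ∀ n ≥ N, approxProb H T f (β n) n < 1 - α n

/-- `f` is mildly hard-on-average to `β`-approximate. -/
def MildlyHoAToApprox (f : List Bool → ℕ) (β : ℕ → ℝ) : Prop :=
  ∃ p : Polynomial ℝ, (∀ n : ℕ, 0 < p.eval (n : ℝ)) ∧
    HoAToApprox f (fun n => 1 / p.eval (n : ℝ)) β

/-! ### Conditionally secure entropy-preserving pseudorandom generators -/

/-- The input `(1^n, y)` of a distinguisher, written as the string `1^n 0 y`. -/
def pairInput (n : ℕ) (y : List Bool) : List Bool := List.replicate n true ++ false :: y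

/-- The running time of `D` on an input `(1^n, y)` is at most `T(n)`, for all coin tosses. -/
def RunsInTimeFirst {k : ℕ} (D : TM Bool k) (T : Polynomial ℕ) : Prop :=
  ∀ (n : ℕ) (y : List Bool) (ρ : ℕ → Bool), (D.run ρ (pairInput n y) (T.eval n)).Halted

/-- `Pr[D(1^n, A) = 1]` for a random variable with law `A` on `{0,1}^m`. -/
noncomputable def acceptProb {k m : ℕ} (D : TM Bool k) (T : Polynomial ℕ) (n : ℕ)
    (A : PMF (Fin m → Bool)) : ℝ :=
  ∑ y : Fin m → Bool, (A y).toReal * coinProb (T.eval n) (fun ρ =>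
    D.Outputs ρ (pairInput n (List.ofFn y)) (T.eval n) [true])

/-- The ensembles `A` and `B` are `μ`-indistinguishable. -/
def Indistinguishable {m : ℕ → ℕ} (μ : ℕ → ℝ) (A B : (n : ℕ) → PMF (Fin (m n) → Bool)) : Prop :=
  ∀ (k : ℕ) (D : TM Bool k) (T : Polynomial ℕ), RunsInTimeFirst D T →
    ∃ N : ℕ, ∀ n ≥ N, |acceptProb D T n (A n) - acceptProb D T n (B n)| < μ n

/-- Shannon entropy, in bits. -/
noncomputable def entropy {V : Type} [Fintype V] (X : PMF V) : ℝ :=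
  ∑ v : V, (X v).toReal * Real.logb 2 (1 / (X v).toReal)

/-- `n + γ log n`, with the second summand rounded down to an integer. -/
noncomputable def outLen (γ : ℝ) (n : ℕ) : ℕ := n + ⌊γ * Real.logb 2 n⌋₊

/-- The machine `M` computes `G` on inputs of length `n` within `T n` steps. -/
def ComputesInTime {k : ℕ} {m : ℕ → ℕ} (M : TM Unit k)
    (G : (n : ℕ) → (Fin n → Bool) → (Fin (m n) → Bool)) (T : ℕ → ℕ) : Prop :=
  ∀ (n : ℕ) (s : Fin n → Bool), M.Computes (List.ofFn s) (T n) (List.ofFn (G n s))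

/-- `G` is computable in polynomial time. -/
def EfficientlyComputable {m : ℕ → ℕ}
    (G : (n : ℕ) → (Fin n → Bool) → (Fin (m n) → Bool)) : Prop :=
  ∃ (k : ℕ) (M : TM Unit k) (T : Polynomial ℕ), ComputesInTime M G (fun n => T.eval n)

/-- Rate-1 efficiency on `(k + 1)`-tape machines: the running time is `n + O(n^a)` for some
constant `a < 1`. -/
def RateOneEfficient (k : ℕ) {m : ℕ → ℕ}
    (G : (n : ℕ) → (Fin n → Bool) → (Fin (m n) → Bool)) : Prop :=
  ∃ (M : TM Unit k) (T : ℕ → ℕ), ComputesInTime M G T ∧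
    ∃ C a : ℝ, a < 1 ∧ ∀ n ≥ 1, (T n : ℝ) ≤ n + C * (n : ℝ) ^ a

/-- `G : {0,1}^n → {0,1}^{n + γ log n}` is a `μ`-conditionally secure entropy-preserving
pseudorandom generator. Here `(PMF.uniformOfFinset (E n) (hE n)).map (G n)` is the law of
`G(U_n | E_n)`. -/
def IsCondEPPRG (μ : ℕ → ℝ) (γ : ℝ)
    (G : (n : ℕ) → (Fin n → Bool) → (Fin (outLen γ n) → Bool)) : Prop :=
  EfficientlyComputable G ∧
  ∃ (E : (n : ℕ) → Finset (Fin n → Bool)) (hE : ∀ n, (E n).Nonempty) (α : ℝ),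
    Indistinguishable μ (fun n => (PMF.uniformOfFinset (E n) (hE n)).map (G n))
        (fun n => PMF.uniformOfFintype (Fin (outLen γ n) → Bool)) ∧
    ∃ N : ℕ, ∀ n ≥ N,
      (n : ℝ) - α * Real.logb 2 n ≤ entropy ((PMF.uniformOfFinset (E n) (hE n)).map (G n))

end CondEP

/-!
Put `m = n + γ log n`. The strings `G(s)` have `K^t`-complexity at most `n + O(1)`, since running
the generator on `s` takes less than `(1 + ε) m` steps, whereas all but a fraction `1/8` of the
strings of length `m` have complexity at least `m - 3`. As `m - n` is much larger than the error
`d log m`, a heuristic that approximates `K^t` well therefore yields a distinguisher: accept `y` if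
the heuristic says at most `(n + m) / 2`.

The heuristic may still fail on the few strings that `G` outputs. This is excluded by the entropy:
a distribution on at most `2 ^ n` strings with entropy `n - α log n` puts only a small mass on the
failures if they make up a fraction `1 / poly(n)` of all strings, with a polynomial of large degree.

Not every number is of the form `n + ⌊γ log n⌋`; those that are missing for the stretch `γ` are,
from some point on, attained for the stretch `2γ`.
-/

namespace CondEP

/-! ### Runs of Turing machines -/

/-- The symbol for a bit. -/
abbrev bit {g : ℕ} (b : Bool) : Sym g := some (Sum.inl b)

/-- The tape that holds the bits of `l` in its first cells and is blank elsewhere. -/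
def listTape {g : ℕ} (l : List Bool) : ℕ → Sym g := fun i => (l[i]?).map Sum.inl

/-- `z` is the string of bits on the tape `Z` from cell `0` up to the first cell without a bit. This
is `TM.Cfg.Reads` for a single tape. -/
def TapeReads {g : ℕ} (Z : ℕ → Sym g) (z : List Bool) : Prop :=
  ∀ i ≤ z.length, TM.bitOf (Z i) = z[i]?

section Tapes

variable {g : ℕ}

theorem listTape_update_length (l : List Bool) (b : Bool) :
    Function.update (listTape l : ℕ → Sym g) l.length (bit b) = listTape (l ++ [b]) := by
  funext i
  rcases lt_trichotomy i l.length with hi | rfl | hi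
  · simp [listTape, hi.ne, List.getElem?_append_left hi]
  · simp [listTape]
  · simp [listTape, hi.ne', List.getElem?_eq_none, hi.le, Nat.succ_le_of_lt hi]

theorem tapeReads_listTape (l : List Bool) : TapeReads (listTape l : ℕ → Sym g) l := by
  intro i _
  cases h : l[i]? <;> simp [listTape, TM.bitOf, h]

theorem TapeReads.unique {Z : ℕ → Sym g} {y z : List Bool} (hy : TapeReads Z y)
    (hz : TapeReads Z z) : y = z := by
  have length_le : ∀ {y z : List Bool}, TapeReads Z y → TapeReads Z z → z.length ≤ y.length := by
    intro y z hy hz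
    by_contra! hlt
    have h := (hy y.length le_rfl).symm.trans (hz y.length hlt.le)
    simp [hlt] at h
  have hlen : y.length = z.length := le_antisymm (length_le hz hy) (length_le hy hz)
  refine List.ext_getElem? fun i => ?_
  rcases le_or_gt i y.length with hi | hi
  · rw [← hy i hi, hz i (hlen ▸ hi)]
  · rw [List.getElem?_eq_none hi.le, List.getElem?_eq_none (hlen ▸ hi.le)]

theorem TapeReads.update_set {Z : ℕ → Sym g} {l : List Bool} (h : TapeReads Z l) {i : ℕ}
    (hi : i < l.length) (b : Bool) : TapeReads (Function.update Z i (bit b)) (l.set i b) := by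
  intro j hj
  rw [List.length_set] at hj
  rcases eq_or_ne j i with rfl | hne
  · simp [TM.bitOf, hi]
  · rw [Function.update_of_ne hne, h j hj, List.getElem?_set_ne hne.symm]

theorem exists_tapeReads {Z : ℕ → Sym g} {j : ℕ} (hj : Z j = none) :
    ∃ z : List Bool, z.length ≤ j ∧ TapeReads Z z := by
  induction j generalizing Z with
  | zero => exact ⟨[], le_rfl, by simp [TapeReads, TM.bitOf, hj]⟩
  | succ j ih =>
    obtain ⟨z, hz, hread⟩ := ih (Z := fun i => Z (i + 1)) hj
    cases hb : TM.bitOf (Z 0) with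
    | none => exact ⟨[], by simp, by simp [TapeReads, hb]⟩
    | some b =>
      refine ⟨b :: z, by simpa using hz, fun i hi => ?_⟩
      cases i with
      | zero => simpa using hb
      | succ i => simpa using hread i (by simpa using hi)

end Tapes

theorem Move.apply_le (m : Move) (i : ℕ) : m.apply i ≤ i + 1 := by
  cases m <;> simp only [Move.apply] <;> omega

namespace TM

variable {C : Type} {k : ℕ} {M : TM C k} {ρ σ : ℕ → C} {x y z : List Bool} {t u : ℕ}

theorem step_of_halted {s : M.Cfg} (h : s.Halted) (c : C) : M.step c s = s :=
  if_pos h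

theorem run_eq_of_halted (h : (M.run ρ x t).Halted) (htu : t ≤ u) :
    M.run ρ x u = M.run ρ x t := by
  induction u, htu using Nat.le_induction with
  | base => rfl
  | succ u _ ih => rw [run, ih, step_of_halted h]

theorem Outputs.mono (h : M.Outputs ρ x t y) (htu : t ≤ u) : M.Outputs ρ x u y := by
  rwa [Outputs, run_eq_of_halted h.1 htu]

theorem Outputs.unique (hy : M.Outputs ρ x t y) (hz : M.Outputs ρ x t z) : y = z :=
  TapeReads.unique hy.2 hz.2

theorem run_congr (h : ∀ i < t, ρ i = σ i) : M.run ρ x t = M.run σ x t := by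
  induction t with
  | zero => rfl
  | succ t ih => rw [run, run, ih fun i hi => h i (hi.trans t.lt_succ_self), h t t.lt_succ_self]

theorem outputs_congr (h : ∀ i < t, ρ i = σ i) : M.Outputs ρ x t y ↔ M.Outputs σ x t y := by
  rw [Outputs, Outputs, run_congr h]

theorem head_run_le (M : TM C k) (ρ : ℕ → C) (x : List Bool) (t : ℕ) (i : Fin (k + 1)) :
    (M.run ρ x t).head i ≤ t := by
  induction t with
  | zero => exact le_rfl
  | succ t ih =>
    rw [run, step]
    split
    · exact ih.trans t.le_succ
    · exact (Move.apply_le _ _).trans (Nat.succ_le_succ ih)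

theorem tape_run_eq_none (M : TM C k) (ρ : ℕ → C) (x : List Bool) (t : ℕ) (i : Fin (k + 1))
    {j : ℕ} (hj : x.length + t ≤ j) : (M.run ρ x t).tape i j = none := by
  induction t with
  | zero => simp [run, init, List.getElem?_eq_none (show x.length ≤ j from hj)]
  | succ t ih =>
    have hhead := head_run_le M ρ x t i
    rw [run, step]
    split
    · exact ih (by omega)
    · simp only
      rw [Function.update_of_ne (by omega), ih (by omega)]

theorem exists_reads (M : TM C k) (ρ : ℕ → C) (x : List Bool) (t : ℕ) :
    ∃ z : List Bool, z.length ≤ x.length + t ∧ (M.run ρ x t).Reads z :=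
  exists_tapeReads (tape_run_eq_none M ρ x t 0 le_rfl)

end TM

/-! ### Machines with labelled states and tapes -/

/-- A Turing machine whose states and tapes are labelled by the elements of arbitrary types. Such
machines are easier to program than those of `TM`, to which `LabelledTM.exists_tm` reduces them. -/
structure LabelledTM (C Q ι : Type) (g : ℕ) where
  start : Q
  halt : Q
  input : ι
  δ : Q → C → (ι → Sym g) → Q × (ι → Sym g × Move)

namespace LabelledTM

/-- A configuration of a machine with states `Q` and tapes `ι`. -/
@[ext]
structure Cfg (Q ι : Type) (g : ℕ) where
  state : Q
  tape : ι → ℕ → Sym g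
  head : ι → ℕ

variable {C Q ι : Type} {g : ℕ}

/-- The symbols that the heads read. -/
def Cfg.read (s : Cfg Q ι g) : ι → Sym g := fun i => s.tape i (s.head i)

/-- The initial configuration on the input `x`, as in `TM.init`. -/
def init [DecidableEq ι] (M : LabelledTM C Q ι g) (x : List Bool) : Cfg Q ι g where
  state := M.start
  tape i := if i = M.input then listTape x else listTape []
  head _ := 0

/-- One step of the computation, as in `TM.step`. -/
def step [DecidableEq Q] (M : LabelledTM C Q ι g) (c : C) (s : Cfg Q ι g) : Cfg Q ι g :=
  if s.state = M.halt then s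
  else
    let a := M.δ s.state c s.read
    { state := a.1
      tape := fun i => Function.update (s.tape i) (s.head i) (a.2 i).1
      head := fun i => (a.2 i).2.apply (s.head i) }

/-- The configuration reached from `s` after `t` steps, where the `i`-th step receives `ρ i`. -/
def runFrom [DecidableEq Q] (M : LabelledTM C Q ι g) (ρ : ℕ → C) (s : Cfg Q ι g) : ℕ → Cfg Q ι g
  | 0 => s
  | t + 1 => M.step (ρ t) (M.runFrom ρ s t)

/-- Whatever the machine receives, it gets from `s` to `s'` in `t` steps. -/
def Reach [DecidableEq Q] (M : LabelledTM C Q ι g) (s : Cfg Q ι g) (t : ℕ) (s' : Cfg Q ι g) :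
    Prop :=
  ∀ ρ : ℕ → C, M.runFrom ρ s t = s'

section Reach

variable [DecidableEq Q] {M : LabelledTM C Q ι g} {s s' s'' : Cfg Q ι g} {t u : ℕ}

theorem runFrom_add (M : LabelledTM C Q ι g) (ρ : ℕ → C) (s : Cfg Q ι g) (a b : ℕ) :
    M.runFrom ρ s (a + b) = M.runFrom (fun i => ρ (a + i)) (M.runFrom ρ s a) b := by
  induction b with
  | zero => rfl
  | succ b ih => rw [← add_assoc, runFrom, ih, runFrom]

theorem Reach.refl (s : Cfg Q ι g) : M.Reach s 0 s := fun _ => rfl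

theorem Reach.trans (h : M.Reach s t s') (h' : M.Reach s' u s'') : M.Reach s (t + u) s'' :=
  fun ρ => by rw [runFrom_add, h, h']

theorem Reach.of_step (h : ∀ c, M.step c s = s') : M.Reach s 1 s' := fun ρ => h (ρ 0)

theorem Reach.head (h : ∀ c, M.step c s = s') (h' : M.Reach s' t s'') : M.Reach s (t + 1) s'' :=
  add_comm 1 t ▸ (Reach.of_step h).trans h'

end Reach

section ToTM

variable {k q : ℕ} (M : LabelledTM C Q ι g) (e : Q ≃ Fin (q + 1)) (f : ι ≃ Fin (k + 1))

/-- The machine obtained by numbering the states and the tapes. -/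
def toTM : TM C k where
  q := q
  g := g
  δ s c r :=
    let a := M.δ (e.symm s) c (r ∘ f)
    (e a.1, fun i => a.2 (f.symm i))

/-- The configuration of `M.toTM e f` that corresponds to a configuration of `M`. -/
def cfgToTM (s : Cfg Q ι g) : (M.toTM e f).Cfg where
  state := e s.state
  tape i := s.tape (f.symm i)
  head i := s.head (f.symm i)

variable {e f}

theorem halted_cfgToTM (hhalt : e M.halt = Fin.last q) (s : Cfg Q ι g) :
    (M.cfgToTM e f s).Halted ↔ s.state = M.halt := by
  rw [← e.injective.eq_iff, hhalt]
  rfl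

theorem step_cfgToTM [DecidableEq Q] (hhalt : e M.halt = Fin.last q) (c : C) (s : Cfg Q ι g) :
    (M.toTM e f).step c (M.cfgToTM e f s) = M.cfgToTM e f (M.step c s) := by
  by_cases h : s.state = M.halt
  · rw [TM.step_of_halted ((M.halted_cfgToTM hhalt s).2 h), step, if_pos h]
  · have hne : (M.cfgToTM e f s).state ≠ Fin.last (M.toTM e f).q :=
      mt (M.halted_cfgToTM hhalt s).1 h
    rw [TM.step, if_neg hne, step, if_neg h]
    simp only [cfgToTM, toTM, Equiv.symm_apply_apply, Function.comp_def]
    rfl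

theorem run_toTM [DecidableEq Q] [DecidableEq ι] (hstart : e M.start = 0)
    (hhalt : e M.halt = Fin.last q) (hinput : f M.input = 0) (ρ : ℕ → C) (x : List Bool) (t : ℕ) :
    (M.toTM e f).run ρ x t = M.cfgToTM e f (M.runFrom ρ (M.init x) t) := by
  induction t with
  | zero =>
    simp only [TM.run, runFrom, TM.init, cfgToTM, init, hstart, Equiv.symm_apply_eq, hinput]
    congr
    funext i j
    split <;> rfl
  | succ t ih => rw [TM.run, ih, M.step_cfgToTM hhalt, runFrom]

end ToTM

theorem exists_equiv_fin_apply_eq_zero [Finite Q] (a : Q) :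
    ∃ (q : ℕ) (e : Q ≃ Fin (q + 1)), e a = 0 := by
  have : Nonempty Q := ⟨a⟩
  obtain ⟨q, hq⟩ := Nat.exists_eq_succ_of_ne_zero (Nat.card_pos (α := Q)).ne'
  let e := Finite.equivFinOfCardEq hq
  exact ⟨q, e.trans (Equiv.swap (e a) 0), by simp⟩

theorem exists_equiv_fin_apply_eq_zero_last [Finite Q] {a b : Q} (hab : a ≠ b) :
    ∃ (q : ℕ) (e : Q ≃ Fin (q + 1)), e a = 0 ∧ e b = Fin.last q := by
  classical
  obtain ⟨q, e, ha⟩ := exists_equiv_fin_apply_eq_zero a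
  have hb : 0 ≠ e b := ha ▸ e.injective.ne hab
  have hlast : 0 ≠ Fin.last q := by
    rintro h
    obtain rfl : q = 0 := (congrArg Fin.val h).symm
    exact hb (Subsingleton.elim (α := Fin 1) _ _)
  refine ⟨q, e.trans (Equiv.swap (e b) (Fin.last q)), ?_, by simp⟩
  rw [Equiv.trans_apply, ha, Equiv.swap_apply_of_ne_of_ne hb hlast]

theorem exists_tm [Finite Q] [Finite ι] [DecidableEq Q] [DecidableEq ι] (M : LabelledTM C Q ι g)
    (hne : M.start ≠ M.halt) : ∃ (k : ℕ) (N : TM C k), ∀ (ρ : ℕ → C) (x : List Bool) (t : ℕ),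
      ((N.run ρ x t).Halted ↔ (M.runFrom ρ (M.init x) t).state = M.halt) ∧
      ∀ y, (N.run ρ x t).Reads y ↔ TapeReads ((M.runFrom ρ (M.init x) t).tape M.input) y := by
  obtain ⟨q, e, hstart, hhalt⟩ := exists_equiv_fin_apply_eq_zero_last hne
  obtain ⟨k, f, hinput⟩ := exists_equiv_fin_apply_eq_zero M.input
  refine ⟨k, M.toTM e f, fun ρ x t => ?_⟩
  rw [M.run_toTM hstart hhalt hinput]
  refine ⟨M.halted_cfgToTM hhalt _, fun y => ?_⟩
  rw [← f.symm_apply_eq.2 hinput.symm]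
  rfl

end LabelledTM

/-! ### Comparing the output of a machine with the length of the input -/

/-- The tapes of `thresholdMachine`. The first tape `main` and the other tapes `work i` of the
simulated machine are accompanied by three tapes with a mark in cell `0`: on `input` and `budget`
the position of the head serves as a counter, and the head of `mirror` follows that of `main`, so
that the machine notices when the latter is in cell `0`. -/
inductive ThresholdTape (k : ℕ) where
  | input
  | mirror
  | budget
  | main
  | work (i : Fin k)
  deriving Fintype, DecidableEq

/-- The states of `thresholdMachine`, where `sim s` simulates the state `s`. -/
inductive ThresholdState (q : ℕ) where
  | start
  | ones
  | ones'
  | copy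
  | rewind (toSim : Bool)
  | sim (s : Fin (q + 1))
  | count
  | pred
  | accept
  | halt
  deriving Fintype, DecidableEq

/-- The actions on the tapes of `thresholdMachine` outside of the simulation. -/
def thresholdActions {g k : ℕ} (r : ThresholdTape k → Sym g) (input : Sym g × Move) (budget : Move)
    (main : Sym g × Move) : ThresholdTape k → Sym g × Move
  | .input => input
  | .mirror => (r .mirror, main.2)
  | .budget => (r .budget, budget)
  | .main => main
  | .work i => (r (.work i), .stay)

/-- On the input `1^n 0 y` with `|y| < 2 n`, the machine simulates `H` on `y` and accepts if the
output denotes a number `v` with `2 v ≤ n + |y|`. It erases its input, leaving the counter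
`P = n + 1 + |y|` in the head position on `input`, while the head of `budget` moves two cells for
each symbol `1` so as to stop the machine when `y` is too long. After the simulation it decrements
`v` by `1` and `P` by `2` as long as possible. -/
def thresholdMachine {k : ℕ} (H : TM Bool k) :
    LabelledTM Bool (ThresholdState H.q) (ThresholdTape k) H.g where
  start := .start
  halt := .halt
  input := .input
  δ
    | .start, _, r =>
      if r .input = bit true then
        (.ones, fun
          | .input => (bit false, .right)
          | .mirror => (bit false, .stay)
          | .budget => (bit false, .right)
          | .main => (none, .stay)
          | .work _ => (none, .stay))
      else (.halt, fun i => (r i, .stay))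
    | .ones, _, r =>
      if r .input = bit true then
        (.ones', thresholdActions r (r .input, .stay) .right (r .main, .stay))
      else (.copy, thresholdActions r (none, .right) .stay (r .main, .stay))
    | .ones', _, r => (.ones, thresholdActions r (none, .right) .right (r .main, .stay))
    | .copy, _, r =>
      if r .input = none then
        (.rewind true, thresholdActions r (r .input, .stay) .stay (r .main, .stay))
      else if r .budget = none then
        (.copy, thresholdActions r (none, .right) .left (r .input, .right))
      else (.halt, thresholdActions r (r .input, .stay) .stay (r .main, .stay))
    | .rewind toSim, _, r =>
      if r .mirror = none then
        (.rewind toSim, thresholdActions r (r .input, .stay) .stay (r .main, .left))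
      else
        (if toSim then .sim 0 else .count,
          thresholdActions r (r .input, .stay) .stay (r .main, .stay))
    | .sim s, c, r =>
      if s = Fin.last H.q then
        (.rewind false, thresholdActions r (r .input, .stay) .stay (r .main, .stay))
      else
        let a := H.δ s c (Fin.cons (r .main) fun i => r (.work i))
        (.sim a.1, fun
          | .input => (r .input, .stay)
          | .mirror => (r .mirror, (a.2 0).2)
          | .budget => (r .budget, .stay)
          | .main => a.2 0
          | .work i => a.2 i.succ)
    | .count, _, r =>
      if r .input = none then
        (.pred, thresholdActions r (r .input, .left) .stay (r .main, .stay))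
      else (.halt, thresholdActions r (r .input, .stay) .stay (r .main, .stay))
    | .pred, _, r =>
      match TM.bitOf (r .main) with
      | some false => (.pred, thresholdActions r (r .input, .stay) .stay (bit true, .right))
      | some true => (.rewind false, thresholdActions r (r .input, .left) .stay (bit false, .stay))
      | none => (.accept, thresholdActions r (r .input, .stay) .stay (r .main, .stay))
    | .accept, _, r =>
      if r .input = none then
        (.accept, thresholdActions r (r .input, .left) .stay (r .main, .stay))
      else (.halt, thresholdActions r (bit true, .stay) .stay (r .main, .stay))
    | .halt, _, r => (.halt, fun i => (r i, .stay))

/-- The tape whose only non-blank symbol is the mark in cell `0`. -/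
def mark {g : ℕ} : ℕ → Sym g := listTape [false]

/-- The tape `input` of `thresholdMachine` when the head is in cell `j > 0` and the machine still
has to read `l`. -/
def unread {g : ℕ} (j : ℕ) (l : List Bool) : ℕ → Sym g :=
  fun i => if i = 0 then bit false else if i < j then none else (l[i - j]?).map Sum.inl

/-- The configurations of `thresholdMachine` after the first step: the tapes `input`, `main` and
`work i` contain `T`, `Z` and `R i`, and the heads of `input`, `budget`, `main` and `work i` are in
the cells `P`, `b`, `p` and `h i`. -/
def thresholdCfg {g k q : ℕ} (s : ThresholdState q) (T : ℕ → Sym g) (P b : ℕ) (Z : ℕ → Sym g)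
    (p : ℕ) (R : Fin k → ℕ → Sym g) (h : Fin k → ℕ) :
    LabelledTM.Cfg (ThresholdState q) (ThresholdTape k) g where
  state := s
  tape
    | .input => T
    | .mirror => mark
    | .budget => mark
    | .main => Z
    | .work i => R i
  head
    | .input => P
    | .mirror => p
    | .budget => b
    | .main => p
    | .work i => h i

section Threshold

variable {g k : ℕ}

theorem mark_zero : (mark : ℕ → Sym g) 0 = bit false := rfl

theorem mark_succ (i : ℕ) : (mark : ℕ → Sym g) (i + 1) = none := rfl

theorem mark_of_ne_zero {i : ℕ} (hi : i ≠ 0) : (mark : ℕ → Sym g) i = none := by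
  obtain ⟨i, rfl⟩ := Nat.exists_eq_succ_of_ne_zero hi
  rfl

theorem unread_nil (j : ℕ) : unread j [] = (mark : ℕ → Sym g) := by
  funext i
  cases i <;> simp [unread, mark, listTape]

theorem unread_self {j : ℕ} (hj : j ≠ 0) (l : List Bool) :
    (unread j l : ℕ → Sym g) j = l.head?.map Sum.inl := by
  simp [unread, hj, List.head?_eq_getElem?]

theorem unread_update {j : ℕ} (hj : j ≠ 0) (a : Bool) (l : List Bool) :
    Function.update (unread j (a :: l) : ℕ → Sym g) j none = unread (j + 1) l := by
  funext i
  rcases lt_trichotomy i j with hi | rfl | hi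
  · simp [unread, hi.ne, hi, Nat.lt_succ_of_lt hi]
  · simp [unread, hj]
  · obtain ⟨m, rfl⟩ := Nat.exists_eq_add_of_lt hi
    rw [Function.update_of_ne (by omega)]
    simp [unread, show j + m + 1 - j = m + 1 by omega, show j + m + 1 - (j + 1) = m by omega,
      show ¬ j + m + 1 < j by omega]

theorem listTape_cons_zero (a : Bool) (l : List Bool) :
    (listTape (a :: l) : ℕ → Sym g) 0 = bit a := rfl

theorem listTape_cons_update (a : Bool) (l : List Bool) :
    Function.update (listTape (a :: l) : ℕ → Sym g) 0 (bit false) = unread 1 l := by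
  funext i
  cases i <;> simp [unread, listTape]

section Read

variable {q : ℕ} (s : ThresholdState q) (T : ℕ → Sym g) (P b : ℕ) (Z : ℕ → Sym g) (p : ℕ)
  (R : Fin k → ℕ → Sym g) (h : Fin k → ℕ)

@[simp]
theorem read_thresholdCfg_input : (thresholdCfg s T P b Z p R h).read .input = T P := rfl

@[simp]
theorem read_thresholdCfg_mirror : (thresholdCfg s T P b Z p R h).read .mirror = mark p := rfl

@[simp]
theorem read_thresholdCfg_budget : (thresholdCfg s T P b Z p R h).read .budget = mark b := rfl

@[simp]
theorem read_thresholdCfg_main : (thresholdCfg s T P b Z p R h).read .main = Z p := rfl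

end Read

variable {H : TM Bool k}

theorem reach_thresholdCfg {s s' : ThresholdState H.q} {T : ℕ → Sym H.g} {P b : ℕ}
    {Z : ℕ → Sym H.g} {p : ℕ} {R : Fin k → ℕ → Sym H.g} {h : Fin k → ℕ}
    {s'' : LabelledTM.Cfg (ThresholdState H.q) (ThresholdTape k) H.g} {t : ℕ}
    (input : Sym H.g × Move) (budget : Move) (main : Sym H.g × Move) (hs : s ≠ .halt)
    (hδ : ∀ c, (thresholdMachine H).δ s c (thresholdCfg s T P b Z p R h).read =
      (s', thresholdActions (thresholdCfg s T P b Z p R h).read input budget main))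
    (hnext : (thresholdMachine H).Reach (thresholdCfg s' (Function.update T P input.1)
      (input.2.apply P) (budget.apply b) (Function.update Z p main.1) (main.2.apply p) R h) t s'') :
    (thresholdMachine H).Reach (thresholdCfg s T P b Z p R h) (t + 1) s'' := by
  refine LabelledTM.Reach.head (fun c => ?_) hnext
  rw [LabelledTM.step, if_neg (by exact hs)]
  rw [show (thresholdCfg s T P b Z p R h).state = s from rfl, hδ c]
  ext i
  · rfl
  all_goals cases i <;> simp [thresholdActions, thresholdCfg, LabelledTM.Cfg.read, Move.apply]

variable {T : ℕ → Sym H.g} {P b : ℕ} {Z : ℕ → Sym H.g} {p : ℕ} {R : Fin k → ℕ → Sym H.g}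
  {h : Fin k → ℕ}

theorem reach_copy_of_ones {j : ℕ} (hj : j ≠ 0) (i : ℕ) (y : List Bool) :
    (thresholdMachine H).Reach
      (thresholdCfg .ones (unread j (List.replicate i true ++ false :: y)) j b Z p R h)
      (2 * i + 1) (thresholdCfg .copy (unread (j + i + 1) y) (j + i + 1) (b + 2 * i) Z p R h) := by
  induction i generalizing j b with
  | zero =>
    refine reach_thresholdCfg (s' := .copy) (none, .right) .stay (Z p, .stay) (by simp)
      (fun c => ?_) ?_
    · simp [thresholdMachine, unread_self hj]
    · simpa [unread_update hj, Move.apply] using LabelledTM.Reach.refl _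
  | succ i ih =>
    refine reach_thresholdCfg (s' := .ones')
      (unread j (List.replicate (i + 1) true ++ false :: y) j, .stay) .right (Z p, .stay) (by simp)
      (fun c => ?_) ?_
    · simp [thresholdMachine, unread_self hj, List.replicate_succ]
    simp only [Function.update_eq_self, Move.apply]
    refine reach_thresholdCfg (s' := .ones) (none, .right) .right (Z p, .stay) (by simp)
      (fun c => ?_) ?_
    · simp [thresholdMachine]
    simp only [List.replicate_succ, List.cons_append, unread_update hj, Function.update_eq_self,
      Move.apply]
    rw [show j + (i + 1) + 1 = j + 1 + i + 1 by ring, show b + 2 * (i + 1) = b + 2 + 2 * i by ring]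
    exact ih (j := j + 1) (b := b + 2) (by simp)

theorem reach_rewind_of_copy {j : ℕ} (hj : j ≠ 0) (u z : List Bool) :
    (thresholdMachine H).Reach
      (thresholdCfg .copy (unread j z) j (b + z.length) (listTape u) u.length R h)
      (z.length + 1)
      (thresholdCfg (.rewind true) mark (j + z.length) b (listTape (u ++ z)) (u ++ z).length
        R h) := by
  induction z generalizing j u with
  | nil =>
    refine reach_thresholdCfg (s' := .rewind true) (unread j [] j, .stay) .stay
      (listTape u u.length, .stay) (by simp) (fun c => ?_) ?_
    · simp [thresholdMachine, unread_self hj]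
    · simpa [unread_nil, Move.apply] using LabelledTM.Reach.refl _
  | cons a z ih =>
    refine reach_thresholdCfg (s' := .copy) (none, .right) .left (bit a, .right) (by simp)
      (fun c => ?_) ?_
    · simp [thresholdMachine, unread_self hj, mark_of_ne_zero]
    simp only [unread_update hj, listTape_update_length, Move.apply]
    have := ih (j := j + 1) (by simp) (u ++ [a])
    convert this using 2 <;> simp; ring

theorem reach_halt_of_copy {j : ℕ} (hj : j ≠ 0) (u : List Bool) {z : List Bool}
    (hb : b < z.length) : ∃ s', s'.state = .halt ∧ (thresholdMachine H).Reach
      (thresholdCfg .copy (unread j z) j b (listTape u) u.length R h) (b + 1) s' := by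
  induction z generalizing j u b with
  | nil => simp at hb
  | cons a z ih =>
    cases b with
    | zero =>
      refine ⟨_, ?_, reach_thresholdCfg (s' := .halt) (bit a, .stay) .stay
        (listTape u u.length, .stay) (by simp) (fun c => ?_) (LabelledTM.Reach.refl _)⟩
      · rfl
      · simp [thresholdMachine, unread_self hj, mark_zero]
    | succ b =>
      obtain ⟨s', hs', hreach⟩ := ih (j := j + 1) (by simp) (u ++ [a]) (b := b) (by simpa using hb)
      refine ⟨s', hs', reach_thresholdCfg (s' := .copy) (none, .right) .left (bit a, .right)
        (by simp) (fun c => ?_) ?_⟩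
      · simp [thresholdMachine, unread_self hj, mark_of_ne_zero]
      simpa [unread_update hj, listTape_update_length, Move.apply] using hreach

theorem reach_of_rewind (toSim : Bool) :
    (thresholdMachine H).Reach (thresholdCfg (.rewind toSim) T P b Z p R h) (p + 1)
      (thresholdCfg (if toSim then .sim 0 else .count) T P b Z 0 R h) := by
  induction p with
  | zero =>
    refine reach_thresholdCfg (s' := if toSim then .sim 0 else .count) (T P, .stay) .stay
      (Z 0, .stay) (by simp) (fun c => ?_) ?_
    · simp [thresholdMachine, mark_zero]
    · simpa [Move.apply] using LabelledTM.Reach.refl _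
  | succ p ih =>
    refine reach_thresholdCfg (s' := .rewind toSim) (T P, .stay) .stay (Z (p + 1), .left)
      (by simp) (fun c => ?_) ?_
    · simp [thresholdMachine, mark_succ]
    · simpa [Move.apply] using ih

theorem reach_of_accept :
    ∃ s', s'.state = .halt ∧ s'.tape .input = listTape [true] ∧
      (thresholdMachine H).Reach (thresholdCfg .accept mark P b Z p R h) (P + 1) s' := by
  induction P with
  | zero =>
    refine ⟨_, ?_, ?_, reach_thresholdCfg (s' := .halt) (bit true, .stay) .stay (Z p, .stay)
      (by simp) (fun c => ?_) (LabelledTM.Reach.refl _)⟩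
    · rfl
    · funext i
      cases i <;> simp [thresholdCfg, mark, listTape]
    · simp [thresholdMachine, mark_zero]
  | succ P ih =>
    obtain ⟨s', hs', htape, hreach⟩ := ih
    refine ⟨s', hs', htape, reach_thresholdCfg (s' := .accept) (none, .left) .stay (Z p, .stay)
      (by simp) (fun c => ?_) ?_⟩
    · simp [thresholdMachine, mark_succ]
    · simpa [Move.apply, ← mark_succ (g := H.g) P] using hreach

theorem binVal_cons (b : Bool) (z : List Bool) : binVal (b :: z) = b.toNat + 2 * binVal z := by
  simp [binVal, Nat.ofDigits_cons]

theorem reach_accept_of_pred {u z : List Bool} (hz : binVal z = 0) (hZ : TapeReads Z (u ++ z)) :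
    ∃ Z' p', (thresholdMachine H).Reach (thresholdCfg .pred mark P b Z u.length R h)
      (z.length + 1) (thresholdCfg .accept mark P b Z' p' R h) := by
  induction z generalizing Z u with
  | nil =>
    refine ⟨Z, u.length, reach_thresholdCfg (s' := .accept) (mark P, .stay) .stay
      (Z u.length, .stay) (by simp) (fun c => ?_) ?_⟩
    · have hread : TM.bitOf (Z u.length) = none := by simpa using hZ u.length
      simp [thresholdMachine, hread]
    · simpa [Move.apply] using LabelledTM.Reach.refl _
  | cons a z ih =>
    rw [binVal_cons] at hz
    obtain rfl : a = false := by cases a <;> simp_all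
    have hZ' : TapeReads (Function.update Z u.length (bit true)) ((u ++ [true]) ++ z) := by
      simpa using hZ.update_set (i := u.length) (by simp) true
    obtain ⟨Z', p', hreach⟩ := ih (u := u ++ [true]) (by simpa using hz) hZ'
    refine ⟨Z', p', reach_thresholdCfg (s' := .pred) (mark P, .stay) .stay (bit true, .right)
      (by simp) (fun c => ?_) ?_⟩
    · have hread : TM.bitOf (Z u.length) = some false := by
        simpa using hZ u.length (by simp)
      simp [thresholdMachine, hread]
    · simpa [Move.apply] using hreach

theorem reach_rewind_of_pred {u z : List Bool} (hz : binVal z ≠ 0) (hZ : TapeReads Z (u ++ z)) :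
    ∃ z' Z' p' t, z'.length = z.length ∧ binVal z' + 1 = binVal z ∧ TapeReads Z' (u ++ z') ∧
      p' ≤ u.length + z.length ∧ t ≤ z.length ∧
      (thresholdMachine H).Reach (thresholdCfg .pred mark P b Z u.length R h) t
        (thresholdCfg (.rewind false) mark (P - 1) b Z' p' R h) := by
  induction z generalizing Z u with
  | nil => simp [binVal] at hz
  | cons a z ih =>
    have hread : TM.bitOf (Z u.length) = some a := by simpa using hZ u.length (by simp)
    have hupdate (c : Bool) :
        TapeReads (Function.update Z u.length (bit c)) (u ++ c :: z) := by
      simpa using hZ.update_set (i := u.length) (by simp) c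
    cases a with
    | true =>
      refine ⟨false :: z, _, u.length, 1, rfl, ?_, hupdate false, by simp, by simp,
        reach_thresholdCfg (s' := .rewind false) (mark P, .left) .stay (bit false, .stay)
        (by simp) (fun c => ?_) ?_⟩
      · simp [binVal_cons, add_comm]
      · simp [thresholdMachine, hread]
      · simpa [Move.apply] using LabelledTM.Reach.refl _
    | false =>
      obtain ⟨z', Z', p', t, hlen, hval, hZ', hp', ht, hreach⟩ := ih (u := u ++ [true])
        (by simpa [binVal_cons] using hz) (by simpa using hupdate true)
      refine ⟨true :: z', Z', p', t + 1, by simpa using hlen, ?_, by simpa using hZ',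
        by simpa [add_assoc, add_comm 1] using hp', by simpa using ht,
        reach_thresholdCfg (s' := .pred) (mark P, .stay) .stay (bit true, .right) (by simp)
        (fun c => ?_) ?_⟩
      · rw [binVal_cons, binVal_cons, ← hval]
        simp only [Bool.toNat_true, Bool.toNat_false]
        ring
      · simp [thresholdMachine, hread]
      · simpa [Move.apply] using hreach

theorem reach_pred_of_count :
    (thresholdMachine H).Reach (thresholdCfg .count mark (P + 1) b Z p R h) 1
      (thresholdCfg .pred mark P b Z p R h) := by
  refine reach_thresholdCfg (s' := .pred) (mark (P + 1), .left) .stay (Z p, .stay) (by simp)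
    (fun c => ?_) ?_
  · simp [thresholdMachine, mark_succ]
  · simpa [Move.apply] using LabelledTM.Reach.refl _

theorem exists_reach_of_count {z : List Bool} (hZ : TapeReads Z z) :
    ∃ s' t, s'.state = .halt ∧ (TapeReads (s'.tape .input) [true] ↔ 2 * binVal z + 1 ≤ P) ∧
      t ≤ (P + 1) * (2 * z.length + 4) ∧
      (thresholdMachine H).Reach (thresholdCfg .count mark P b Z 0 R h) t s' := by
  induction P using Nat.strong_induction_on generalizing z Z with
  | _ P ih =>
    rcases P with _ | P
    · refine ⟨_, 1, ?_, ?_, ?_, reach_thresholdCfg (s' := .halt) (mark 0, .stay) .stay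
        (Z 0, .stay) (by simp) (fun c => ?_) (LabelledTM.Reach.refl _)⟩
      · rfl
      · suffices ¬ TapeReads (mark : ℕ → Sym H.g) [true] by simpa [thresholdCfg] using this
        exact fun hmark => by simpa using (tapeReads_listTape [false]).unique hmark
      · omega
      · simp [thresholdMachine, mark_zero]
    by_cases hz : binVal z = 0
    · obtain ⟨Z', p', hpred⟩ := reach_accept_of_pred (P := P) (b := b) (R := R) (h := h) (u := [])
        hz hZ
      obtain ⟨s', hs', htape, haccept⟩ := reach_of_accept (P := P) (b := b) (Z := Z') (p := p')
        (R := R) (h := h)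
      refine ⟨s', _, hs', ?_, ?_, reach_pred_of_count.trans (hpred.trans haccept)⟩
      · simp [htape, tapeReads_listTape, hz]
      · nlinarith
    · obtain ⟨z', Z', p', t₁, hlen, hval, hZ', hp', ht₁, hpred⟩ :=
        reach_rewind_of_pred (P := P) (b := b) (R := R) (h := h) (u := []) hz hZ
      obtain ⟨s', t₂, hs', hiff, ht₂, hcount⟩ := ih (P - 1) (by omega) (z := z') hZ'
      refine ⟨s', _, hs', ?_, ?_,
        reach_pred_of_count.trans (hpred.trans ((reach_of_rewind false).trans hcount))⟩
      · rw [hiff]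
        omega
      · have hmono : (P - 1 + 1) * (2 * z'.length + 4) ≤ (P + 1) * (2 * z.length + 4) := by
          rw [hlen]
          gcongr
          omega
        simp only [List.length_nil, zero_add] at hp'
        rw [add_one_mul (P + 1)]
        omega

/-- The configuration of `thresholdMachine` that corresponds to the configuration `s` of `H`. -/
def simCfg (P b : ℕ) (s : H.Cfg) : LabelledTM.Cfg (ThresholdState H.q) (ThresholdTape k) H.g :=
  thresholdCfg (.sim s.state) mark P b (s.tape 0) (s.head 0) (fun i => s.tape i.succ)
    fun i => s.head i.succ

theorem step_simCfg {s : H.Cfg} (hs : ¬ s.Halted) (c : Bool) :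
    (thresholdMachine H).step c (simCfg P b s) = simCfg P b (H.step c s) := by
  have hne : s.state ≠ Fin.last H.q := hs
  have hread : (Fin.cons (s.tape 0 (s.head 0)) fun i => s.tape i.succ (s.head i.succ) :
      Fin (k + 1) → Sym H.g) = fun i => s.tape i (s.head i) :=
    Fin.cons_self_tail (fun i => s.tape i (s.head i))
  rw [TM.step, if_neg hne, LabelledTM.step, if_neg (show (simCfg P b s).state ≠
    (thresholdMachine H).halt by simp [simCfg, thresholdCfg, thresholdMachine])]
  ext i
  · simp [simCfg, thresholdCfg, thresholdMachine, LabelledTM.Cfg.read, hne, hread]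
  all_goals cases i <;>
    simp [simCfg, thresholdCfg, thresholdMachine, LabelledTM.Cfg.read, hne, hread, Move.apply]

theorem exists_runFrom_simCfg (σ : ℕ → Bool) (y : List Bool) (t : ℕ) :
    ∃ τ ≤ t, (τ = t ∨ (H.run σ y t).Halted) ∧
      (thresholdMachine H).runFrom σ (simCfg P b (H.init y)) τ = simCfg P b (H.run σ y t) := by
  induction t with
  | zero => exact ⟨0, le_rfl, .inl rfl, rfl⟩
  | succ t ih =>
    obtain ⟨τ, hτ, hor, hrun⟩ := ih
    by_cases hhalt : (H.run σ y t).Halted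
    · refine ⟨τ, hτ.trans t.le_succ, .inr ?_, ?_⟩ <;>
        rwa [TM.run_eq_of_halted hhalt t.le_succ]
    · obtain rfl : τ = t := hor.resolve_right hhalt
      refine ⟨τ + 1, le_rfl, .inl rfl, ?_⟩
      rw [LabelledTM.runFrom, hrun, step_simCfg hhalt, TM.run]

theorem reach_count_of_simCfg {s : H.Cfg} (hs : s.Halted) :
    (thresholdMachine H).Reach (simCfg P b s) (s.head 0 + 2)
      (thresholdCfg .count mark P b (s.tape 0) 0 (fun i => s.tape i.succ)
        fun i => s.head i.succ) := by
  refine reach_thresholdCfg (s' := .rewind false) (mark P, .stay) .stay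
    (s.tape 0 (s.head 0), .stay) (by simp) (fun c => ?_) ?_
  · simp [thresholdMachine, show s.state = Fin.last H.q from hs]
  · simpa [Move.apply] using reach_of_rewind false

theorem reach_ones_of_init (n : ℕ) (y : List Bool) :
    (thresholdMachine H).Reach ((thresholdMachine H).init (pairInput (n + 1) y)) 1
      (thresholdCfg .ones (unread 1 (List.replicate n true ++ false :: y)) 1 1 (listTape []) 0
        (fun _ => listTape []) fun _ => 0) := by
  refine LabelledTM.Reach.of_step fun c => ?_
  have hinput : pairInput (n + 1) y = true :: (List.replicate n true ++ false :: y) := rfl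
  have hmark : Function.update (listTape [] : ℕ → Sym H.g) 0 (bit false) = mark :=
    listTape_update_length [] false
  have hblank : Function.update (listTape [] : ℕ → Sym H.g) 0 none = listTape [] :=
    Function.update_eq_self 0 (listTape [])
  rw [LabelledTM.step, if_neg (by simp [LabelledTM.init, thresholdMachine])]
  ext : 1
  · simp [LabelledTM.init, thresholdMachine, LabelledTM.Cfg.read, thresholdCfg, hinput,
      listTape_cons_zero]
  all_goals
    funext i
    cases i <;>
    simp [LabelledTM.init, thresholdMachine, LabelledTM.Cfg.read, thresholdCfg, Move.apply,
      hinput, listTape_cons_zero, listTape_cons_update, hmark, hblank]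

theorem simCfg_init (y : List Bool) : simCfg P b (H.init y) = thresholdCfg (.sim 0) mark P b
    (listTape y) 0 (fun _ => listTape []) fun _ => 0 := by
  simp [simCfg, TM.init]
  rfl

theorem reach_simCfg {n : ℕ} {y : List Bool} (hy : y.length < 2 * n) :
    ∃ b, (thresholdMachine H).Reach ((thresholdMachine H).init (pairInput n y))
      (2 * n + 2 * y.length + 2) (simCfg (n + 1 + y.length) b (H.init y)) := by
  obtain ⟨n, rfl⟩ := Nat.exists_eq_add_one_of_ne_zero (show n ≠ 0 by omega)
  obtain ⟨b, hb⟩ := Nat.exists_eq_add_of_le' (show y.length ≤ 1 + 2 * n by omega)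
  have hones := (reach_ones_of_init (H := H) n y).trans (reach_copy_of_ones one_ne_zero n y)
  rw [hb] at hones
  have hcopy := hones.trans (reach_rewind_of_copy (by omega) [] y)
  have hsim := hcopy.trans (reach_of_rewind true)
  refine ⟨b, ?_⟩
  rw [simCfg_init]
  convert hsim using 1
  · simp only [List.nil_append]
    ring
  · simp [add_comm 1]

theorem exists_reach_halt {n : ℕ} {y : List Bool} (hy : 2 * n ≤ y.length) :
    ∃ s' t, s'.state = .halt ∧ t ≤ 4 * n + 1 ∧
      (thresholdMachine H).Reach ((thresholdMachine H).init (pairInput n y)) t s' := by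
  cases n with
  | zero =>
    refine ⟨(thresholdMachine H).step false _, 1, ?_, by simp,
      LabelledTM.Reach.of_step fun c => rfl⟩
    rw [LabelledTM.step, if_neg (by simp [LabelledTM.init, thresholdMachine])]
    simp [LabelledTM.init, thresholdMachine, LabelledTM.Cfg.read, pairInput, listTape_cons_zero]
  | succ n =>
    obtain ⟨s', hs', hreach⟩ := reach_halt_of_copy (H := H) (j := 1 + n + 1) (b := 1 + 2 * n)
      (by omega) [] (by omega : 1 + 2 * n < y.length)
    refine ⟨s', _, hs', ?_, (reach_ones_of_init n y).trans
      ((reach_copy_of_ones one_ne_zero n y).trans hreach)⟩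
    omega

theorem exists_runFrom_thresholdMachine {n : ℕ} {y : List Bool} (hy : y.length < 2 * n)
    (ρ : ℕ → Bool) {t : ℕ}
    (ht : (H.run (fun i => ρ (2 * n + 2 * y.length + 2 + i)) y t).Halted) :
    ∃ u ≤ 2 * n + 2 * y.length + 4 + 2 * t +
        (n + 1 + y.length + 1) * (2 * (y.length + t) + 4),
      let s := (thresholdMachine H).runFrom ρ ((thresholdMachine H).init (pairInput n y)) u
      s.state = .halt ∧ (TapeReads (s.tape .input) [true] ↔
        ∃ z, H.Outputs (fun i => ρ (2 * n + 2 * y.length + 2 + i)) y t z ∧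
          2 * binVal z ≤ n + y.length) := by
  obtain ⟨b, hinit⟩ := reach_simCfg (H := H) hy
  set σ : ℕ → Bool := fun i => ρ (2 * n + 2 * y.length + 2 + i)
  obtain ⟨τ, hτ, _, hsim⟩ :=
    exists_runFrom_simCfg (H := H) (P := n + 1 + y.length) (b := b) σ y t
  have hrun : (thresholdMachine H).runFrom ρ ((thresholdMachine H).init (pairInput n y))
      (2 * n + 2 * y.length + 2 + τ) = simCfg (n + 1 + y.length) b (H.run σ y t) := by
    rw [LabelledTM.runFrom_add, hinit, hsim]
  obtain ⟨z, hzl, hz⟩ := H.exists_reads σ y t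
  obtain ⟨s', v, hs', hiff, hv, hcount⟩ := exists_reach_of_count (P := n + 1 + y.length) (b := b)
    (R := fun i => (H.run σ y t).tape i.succ) (h := fun i => (H.run σ y t).head i.succ) hz
  have hfinal := (reach_count_of_simCfg ht).trans hcount
  refine ⟨2 * n + 2 * y.length + 2 + τ + ((H.run σ y t).head 0 + 2 + v), ?_, ?_⟩
  · have hhead := H.head_run_le σ y t 0
    have hmono : (n + 1 + y.length + 1) * (2 * z.length + 4) ≤
        (n + 1 + y.length + 1) * (2 * (y.length + t) + 4) := by gcongr
    omega
  · rw [LabelledTM.runFrom_add, hrun, hfinal]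
    refine ⟨hs', hiff.trans ⟨fun h => ⟨z, ⟨ht, hz⟩, by omega⟩, ?_⟩⟩
    rintro ⟨z', hz', h⟩
    rw [TapeReads.unique hz hz'.2]
    omega

end Threshold

/-! ### Probabilities over coin tosses -/

section CoinProb

variable {T : ℕ} {P Q : (ℕ → Bool) → Prop}

theorem coinProb_nonneg : 0 ≤ coinProb T P := by
  unfold coinProb
  positivity

theorem coinProb_mono (h : ∀ ρ, P ρ → Q ρ) : coinProb T P ≤ coinProb T Q := by
  unfold coinProb
  gcongr
  exact Nat.card_le_card_of_injective (Subtype.map id fun r => h _)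
    (Subtype.map_injective _ Function.injective_id)

theorem coinProb_add_le_one (h : ∀ ρ, P ρ → ¬ Q ρ) : coinProb T P + coinProb T Q ≤ 1 := by
  have hcard : Nat.card (Fin T → Bool) = 2 ^ T := by simp
  rw [coinProb, coinProb, ← add_div, div_le_one (by positivity), ← Nat.cast_add, ← Nat.card_sum]
  suffices hinj : Function.Injective (Sum.elim
      (Subtype.val : {r : Fin T → Bool // P fun i => if h : i < T then r ⟨i, h⟩ else false} → _)
      (Subtype.val : {r : Fin T → Bool // Q fun i => if h : i < T then r ⟨i, h⟩ else false} → _))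
      from mod_cast (Nat.card_le_card_of_injective _ hinj).trans hcard.le
  refine Subtype.val_injective.sumElim Subtype.val_injective fun r s hrs => h _ r.2 ?_
  rw [hrs]
  exact s.2

theorem coinProb_le_one : coinProb T P ≤ 1 :=
  (le_add_of_nonneg_right coinProb_nonneg).trans
    (coinProb_add_le_one (Q := fun ρ => ¬ P ρ) fun _ => not_not_intro)

end CoinProb

theorem card_comp_injective {S T A : Type*} [Finite A] [Finite T] {e : S → T}
    (he : Function.Injective e) : ∃ N : ℕ, ∀ Q : (S → A) → Prop,
      Nat.card {r : T → A // Q (r ∘ e)} = Nat.card {r : S → A // Q r} * N := by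
  classical
  let split : (T → A) ≃ (S → A) × ({x // x ∉ Set.range e} → A) :=
    (Equiv.piEquivPiSubtypeProd (· ∈ Set.range e) fun _ => A).trans
      (Equiv.prodCongrLeft fun _ => (Equiv.ofInjective e he).symm.arrowCongr (Equiv.refl A))
  refine ⟨Nat.card ({x // x ∉ Set.range e} → A), fun Q => ?_⟩
  rw [← Nat.card_prod]
  exact Nat.card_congr ((split.subtypeEquiv (q := fun u => Q u.1) fun r => Iff.rfl).trans
    Equiv.prodSubtypeFstEquivSubtypeProd)

theorem coinProb_shift {a S T : ℕ} (h : a + S ≤ T) {P : (ℕ → Bool) → Prop}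
    (hP : ∀ ρ σ : ℕ → Bool, (∀ i < S, ρ i = σ i) → (P ρ ↔ P σ)) :
    coinProb T (fun ρ => P fun i => ρ (a + i)) = coinProb S P := by
  let e : Fin S → Fin T := fun i => ⟨a + i, by omega⟩
  have he : Function.Injective e := fun i j hij => by
    simpa [e, Fin.ext_iff] using hij
  obtain ⟨N, hN⟩ := card_comp_injective (A := Bool) he
  have htotal : (2 : ℝ) ^ T = 2 ^ S * N := by
    have := hN fun _ => True
    exact_mod_cast (by simpa using this : 2 ^ T = 2 ^ S * N)
  have hN0 : (N : ℝ) ≠ 0 := fun h0 => by simp [h0] at htotal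
  have hshift : Nat.card {r : Fin T → Bool //
        P fun i => if h : a + i < T then r ⟨a + i, h⟩ else false} =
      Nat.card {r : Fin T → Bool // P fun i => if h : i < S then (r ∘ e) ⟨i, h⟩ else false} := by
    refine Nat.card_congr (Equiv.subtypeEquivRight fun r => hP _ _ fun i hi => ?_)
    simp [hi, show a + i < T by omega, e]
  rw [coinProb, coinProb, hshift,
    hN fun r => P fun i => if h : i < S then r ⟨i, h⟩ else false, htotal, Nat.cast_mul]
  exact mul_div_mul_right _ _ hN0

/-- The probability that the machine `H`, run on `x` for `t` steps, halts with a number satisfying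
`p` as its output. -/
noncomputable def valueProb {k : ℕ} (H : TM Bool k) (t : ℕ) (x : List Bool) (p : ℕ → Prop) : ℝ :=
  coinProb t fun ρ => ∃ y, H.Outputs ρ x t y ∧ p (binVal y)

section ValueProb

variable {k : ℕ} {H : TM Bool k} {t : ℕ} {x : List Bool} {p q : ℕ → Prop}

theorem valueProb_nonneg : 0 ≤ valueProb H t x p :=
  coinProb_nonneg

theorem valueProb_le_one : valueProb H t x p ≤ 1 :=
  coinProb_le_one

theorem valueProb_mono (h : ∀ v, p v → q v) : valueProb H t x p ≤ valueProb H t x q :=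
  coinProb_mono fun _ ⟨y, hy, hp⟩ => ⟨y, hy, h _ hp⟩

theorem valueProb_add_le_one (h : ∀ v, p v → ¬ q v) :
    valueProb H t x p + valueProb H t x q ≤ 1 := by
  refine coinProb_add_le_one ?_
  rintro ρ ⟨y, hy, hp⟩ ⟨z, hz, hq⟩
  exact h _ hp (TM.Outputs.unique hy hz ▸ hq)

theorem coinProb_shift_outputs {a T : ℕ} (h : a + t ≤ T) :
    coinProb T (fun ρ => ∃ y, H.Outputs (fun i => ρ (a + i)) x t y ∧ p (binVal y)) =
      valueProb H t x p :=
  coinProb_shift (P := fun ρ => ∃ y, H.Outputs ρ x t y ∧ p (binVal y)) h fun _ _ hρσ => by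
    simp only [TM.outputs_congr hρσ]

end ValueProb

/-- The machine `D` with time bound `TD`, given `(1^n, y)` with `|y| < 2n`, accepts if and only if
`H`, run on `y` with time bound `T`, outputs a number `≤ (n + |y|) / 2`. -/
def IsThresholdTest {k k' : ℕ} (D : TM Bool k') (TD : Polynomial ℕ) (H : TM Bool k)
    (T : Polynomial ℕ) : Prop :=
  ∀ (n : ℕ) (y : List Bool), y.length < 2 * n →
    coinProb (TD.eval n) (fun ρ => D.Outputs ρ (pairInput n y) (TD.eval n) [true]) =
      valueProb H (T.eval y.length) y fun v => 2 * v ≤ n + y.length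

theorem polynomial_eval_mono (T : Polynomial ℕ) : Monotone fun n => T.eval n := fun a b h => by
  simp only [Polynomial.eval_eq_sum, Polynomial.sum_def]
  gcongr

theorem exists_tm_threshold {k : ℕ} (H : TM Bool k) : ∃ (k' : ℕ) (D : TM Bool k'),
    (∀ (n : ℕ) (y : List Bool) (ρ : ℕ → Bool), 2 * n ≤ y.length →
      ∀ u ≥ 4 * n + 1, (D.run ρ (pairInput n y) u).Halted) ∧
    ∀ (n : ℕ) (y : List Bool) (ρ : ℕ → Bool) (t : ℕ), y.length < 2 * n →
      (H.run (fun i => ρ (2 * n + 2 * y.length + 2 + i)) y t).Halted →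
      ∀ u ≥ 2 * n + 2 * y.length + 4 + 2 * t + (n + 1 + y.length + 1) * (2 * (y.length + t) + 4),
        (D.run ρ (pairInput n y) u).Halted ∧
        (D.Outputs ρ (pairInput n y) u [true] ↔
          ∃ z, H.Outputs (fun i => ρ (2 * n + 2 * y.length + 2 + i)) y t z ∧
            2 * binVal z ≤ n + y.length) := by
  obtain ⟨k', D, hD⟩ := (thresholdMachine H).exists_tm (by simp [thresholdMachine])
  refine ⟨k', D, fun n y ρ hy u hu => ?_, fun n y ρ t hy ht u hu => ?_⟩
  · obtain ⟨s, τ, hs, hτ, hreach⟩ := exists_reach_halt (H := H) hy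
    have hhalt := (hD ρ (pairInput n y) τ).1.2 ((congrArg _ (hreach ρ)).trans hs)
    rwa [TM.run_eq_of_halted hhalt (hτ.trans hu)]
  · obtain ⟨τ, hτ, hs, hreads⟩ := exists_runFrom_thresholdMachine hy ρ ht
    obtain ⟨hhalt, hDreads⟩ := hD ρ (pairInput n y) τ
    replace hs := hhalt.2 hs
    rw [TM.Outputs, TM.run_eq_of_halted hs (hτ.trans hu)]
    exact ⟨hs, (and_iff_right hs).trans ((hDreads _).trans hreads)⟩

theorem exists_isThresholdTest {k : ℕ} (H : TM Bool k) (T : Polynomial ℕ)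
    (hT : RunsInTime H T) : ∃ (k' : ℕ) (D : TM Bool k') (TD : Polynomial ℕ),
      RunsInTimeFirst D TD ∧ IsThresholdTest D TD H T := by
  obtain ⟨k', D, hlong, hshort⟩ := exists_tm_threshold H
  let T₂ : Polynomial ℕ := T.comp (2 * Polynomial.X)
  let TD : Polynomial ℕ := 6 * Polynomial.X + 4 + 2 * T₂ +
    (3 * Polynomial.X + 1) * (2 * (2 * Polynomial.X + T₂) + 4)
  have hTD (n : ℕ) : TD.eval n = 6 * n + 4 + 2 * T.eval (2 * n) +
      (3 * n + 1) * (2 * (2 * n + T.eval (2 * n)) + 4) := by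
    simp [TD, T₂]
  have hbound {n : ℕ} {y : List Bool} (hy : y.length < 2 * n) :
      2 * n + 2 * y.length + 4 + 2 * T.eval y.length +
        (n + 1 + y.length + 1) * (2 * (y.length + T.eval y.length) + 4) ≤ TD.eval n := by
    have hT₂ : T.eval y.length ≤ T.eval (2 * n) := polynomial_eval_mono T hy.le
    have hcount : (n + 1 + y.length + 1) * (2 * (y.length + T.eval y.length) + 4) ≤
        (3 * n + 1) * (2 * (2 * n + T.eval (2 * n)) + 4) := by
      gcongr ?_ * (2 * (?_ + ?_) + 4)
      omega
    rw [hTD]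
    omega
  refine ⟨k', D, TD, fun n y ρ => ?_, fun n y hy => ?_⟩
  · rcases lt_or_ge y.length (2 * n) with hy | hy
    · exact (hshort n y ρ _ hy (hT y _) _ (hbound hy)).1
    · exact hlong n y ρ hy _ (by rw [hTD]; omega)
  · simp only [(hshort n y _ _ hy (hT y _) _ (hbound hy)).2]
    refine coinProb_shift_outputs (p := fun v => 2 * v ≤ n + y.length) ?_
    have := hbound hy
    omega

/-! ### Entropy -/

theorem sum_toReal_eq_one {V : Type*} [Fintype V] (X : PMF V) : ∑ v, (X v).toReal = 1 := by
  rw [← ENNReal.toReal_sum fun v _ => X.apply_ne_top v, ← tsum_fintype (L := .unconditional V),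
    X.tsum_coe, ENNReal.toReal_one]

theorem mul_logb_one_div_le {x r : ℝ} (hx : 0 ≤ x) (hr : 0 ≤ r) (hxr : r = 0 → x = 0) :
    x * Real.logb 2 (1 / x) ≤ x * Real.logb 2 (1 / r) + (r - x) / Real.log 2 := by
  have hlog : 0 < Real.log 2 := Real.log_pos one_lt_two
  rcases hx.eq_or_lt with rfl | hx
  · simpa using div_nonneg hr hlog.le
  have hr : 0 < r := hr.lt_of_ne' (mt hxr hx.ne')
  have hkl := mul_nonneg hr.le (InformationTheory.klFun_nonneg (div_pos hx hr).le)
  have hexpand : r * InformationTheory.klFun (x / r) =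
      (x * Real.log x - x * Real.log r) + (r - x) := by
    rw [InformationTheory.klFun_apply, Real.log_div hx.ne' hr.ne']
    field_simp
    ring
  simp only [Real.logb, one_div, Real.log_inv, mul_div_assoc', ← add_div]
  gcongr
  linarith

section Entropy

variable {V : Type} [Fintype V]

theorem entropy_le_sum_mul_logb (X : PMF V) {r : V → ℝ} (hr : ∀ v, 0 ≤ r v)
    (hX : ∀ v, r v = 0 → X v = 0) (hsum : ∑ v, r v ≤ 1) :
    entropy X ≤ ∑ v, (X v).toReal * Real.logb 2 (1 / r v) := by
  calc entropy X ≤ ∑ v, ((X v).toReal * Real.logb 2 (1 / r v) +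
        (r v - (X v).toReal) / Real.log 2) := Finset.sum_le_sum fun v _ =>
          mul_logb_one_div_le ENNReal.toReal_nonneg (hr v) fun h => by simp [hX v h]
    _ = ∑ v, (X v).toReal * Real.logb 2 (1 / r v) + (∑ v, r v - 1) / Real.log 2 := by
      rw [Finset.sum_add_distrib, ← Finset.sum_div, Finset.sum_sub_distrib, sum_toReal_eq_one]
    _ ≤ _ := add_le_of_nonpos_right
      (div_nonpos_of_nonpos_of_nonneg (by linarith) (Real.log_pos one_lt_two).le)

variable {X : PMF V} {S W : Finset V} {A B C : ℝ}

theorem entropy_le_logb_add_sum {c : V → ℝ} (hX : ∀ v, X v ≠ 0 → v ∈ W) (hc : ∀ v, 0 < c v)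
    (hC : 0 < C) (hsum : ∑ v ∈ W, (c v)⁻¹ ≤ C) :
    entropy X ≤ Real.logb 2 C + ∑ v, (X v).toReal * Real.logb 2 (c v) := by
  classical
  let r : V → ℝ := fun v => if v ∈ W then (c v)⁻¹ / C else 0
  have hr (v : V) : 0 ≤ r v := by
    have := hc v
    simp only [r]
    positivity
  have hr0 (v : V) (hv : r v = 0) : X v = 0 := by
    contrapose! hv
    simp only [r, if_pos (hX v hv)]
    exact (div_pos (inv_pos.2 (hc v)) hC).ne'
  refine (entropy_le_sum_mul_logb X hr hr0 ?_).trans_eq ?_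
  · rwa [Finset.sum_ite_mem_eq, ← Finset.sum_div, div_le_one hC]
  · have hlogC : Real.logb 2 C = ∑ v, (X v).toReal * Real.logb 2 C := by
      rw [← Finset.sum_mul, sum_toReal_eq_one, one_mul]
    rw [hlogC, ← Finset.sum_add_distrib]
    refine Finset.sum_congr rfl fun v _ => ?_
    by_cases hv : X v = 0
    · simp [hv]
    · simp only [r, if_pos (hX v hv), one_div_div, div_inv_eq_mul]
      rw [Real.logb_mul hC.ne' (hc v).ne', mul_add]

theorem entropy_le_of_card_le (hX : ∀ v, X v ≠ 0 → v ∈ W) (hA : 0 < A) (hB : 0 < B)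
    (hW : (W.card : ℝ) ≤ A) (hS : (S.card : ℝ) ≤ B) :
    entropy X ≤ 1 + (∑ v ∈ S, (X v).toReal) * Real.logb 2 B +
      (1 - ∑ v ∈ S, (X v).toReal) * Real.logb 2 A := by
  classical
  have hsum : ∑ v ∈ W, (if v ∈ S then B else A)⁻¹ ≤ 2 := by
    calc _ ≤ ∑ v ∈ W, ((if v ∈ S then B⁻¹ else 0) + A⁻¹) := by
          refine Finset.sum_le_sum fun v _ => ?_
          split_ifs <;> simp [hA.le]
      _ = (W ∩ S).card * B⁻¹ + W.card * A⁻¹ := by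
          rw [Finset.sum_add_distrib, Finset.sum_ite_mem]
          simp only [Finset.sum_const, nsmul_eq_mul]
      _ ≤ S.card * B⁻¹ + W.card * A⁻¹ := by
          gcongr
          exact Finset.inter_subset_right
      _ ≤ 1 + 1 := by
          gcongr
          · exact mul_inv_le_one_of_le₀ hS hB.le
          · exact mul_inv_le_one_of_le₀ hW hA.le
      _ = 2 := one_add_one_eq_two
  refine (entropy_le_logb_add_sum hX (fun v => ?_) two_pos hsum).trans_eq ?_
  · positivity
  have hcompl := Finset.sum_add_sum_compl S fun v => (X v).toReal
  rw [sum_toReal_eq_one, ← eq_sub_iff_add_eq'] at hcompl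
  rw [Real.logb_self_eq_one one_lt_two, ← Finset.sum_add_sum_compl S, ← hcompl, add_assoc,
    Finset.sum_mul, Finset.sum_mul]
  congr 2
  · exact Finset.sum_congr rfl fun v hv => by rw [if_pos hv]
  · exact Finset.sum_congr rfl fun v hv => by rw [if_neg (Finset.mem_compl.1 hv)]

theorem sum_toReal_le_half_of_entropy_ge (hX : ∀ v, X v ≠ 0 → v ∈ W) (hA : 0 < A)
    (hW : (W.card : ℝ) ≤ A) {h : ℝ} (hh : 0 ≤ h) (hS : S.card * (2 : ℝ) ^ (2 * (h + 1)) ≤ A)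
    (hent : Real.logb 2 A - h ≤ entropy X) : ∑ v ∈ S, (X v).toReal ≤ 1 / 2 := by
  have hB := (le_div_iff₀ (by positivity)).2 hS
  have hsplit := entropy_le_of_card_le hX hA (by positivity) hW hB
  rw [Real.logb_div hA.ne' (by positivity), Real.logb_rpow two_pos (by norm_num)] at hsplit
  have : (h + 1) * (2 * ∑ v ∈ S, (X v).toReal) ≤ (h + 1) * 1 := by linarith
  linarith [le_of_mul_le_mul_left this (by linarith)]

end Entropy

section Advantage

variable {V : Type*} [Fintype V] {X : PMF V} {S₀ : Finset V} {a g : V → ℝ}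

theorem card_filter_lt_half_le (hg : ∀ v, g v ≤ 1) :
    ((Finset.univ.filter fun v => g v < 1 / 2).card : ℝ) ≤ 2 * ∑ v, (1 - g v) := by
  rw [Finset.cast_card, Finset.sum_filter, Finset.mul_sum]
  refine Finset.sum_le_sum fun v _ => ?_
  split_ifs <;> linarith [hg v]

theorem quarter_le_sum_mul (ha : ∀ v, 0 ≤ a v) (hag : ∀ v, X v ≠ 0 → g v ≤ a v)
    (hX : ∑ v with g v < 1 / 2, (X v).toReal ≤ 1 / 2) : 1 / 4 ≤ ∑ v, (X v).toReal * a v := by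
  have hcompl := Finset.sum_filter_add_sum_filter_not Finset.univ (fun v => g v < 1 / 2)
    fun v => (X v).toReal
  rw [sum_toReal_eq_one] at hcompl
  calc 1 / 4 ≤ ∑ v with ¬ g v < 1 / 2, (X v).toReal * (1 / 2) := by
        rw [← Finset.sum_mul]
        linarith
    _ ≤ ∑ v with ¬ g v < 1 / 2, (X v).toReal * a v := by
        refine Finset.sum_le_sum fun v hv => ?_
        by_cases hXv : X v = 0
        · simp [hXv]
        · gcongr
          exact (not_lt.1 (Finset.mem_filter.1 hv).2).trans (hag v hXv)
    _ ≤ _ := Finset.sum_le_univ_sum_of_nonneg fun v =>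
        mul_nonneg ENNReal.toReal_nonneg (ha v)

theorem sum_le_sum_one_sub_add_card (ha : ∀ v, a v ≤ 1) (hg : ∀ v, g v ≤ 1)
    (hS₀ : ∀ v ∉ S₀, a v + g v ≤ 1) : ∑ v, a v ≤ ∑ v, (1 - g v) + S₀.card := by
  classical
  calc ∑ v, a v ≤ ∑ v, ((1 - g v) + if v ∈ S₀ then 1 else 0) := by
        refine Finset.sum_le_sum fun v _ => ?_
        split_ifs with hv
        · linarith [ha v, hg v]
        · linarith [hS₀ v hv]
    _ = _ := by rw [Finset.sum_add_distrib, Finset.sum_ite_mem_eq, Finset.cast_card]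

end Advantage

/-- `a` is the acceptance probability of a test and `g` the success probability of the heuristic
on which the test is based. -/
theorem sixteenth_le_advantage {V : Type} [Fintype V] {X : PMF V}
    {S₀ W : Finset V} {a g : V → ℝ} (ha₀ : ∀ v, 0 ≤ a v) (ha₁ : ∀ v, a v ≤ 1) (hg : ∀ v, g v ≤ 1)
    (hag : ∀ v, X v ≠ 0 → g v ≤ a v) (hS₀ : ∀ v ∉ S₀, a v + g v ≤ 1)
    (hS₀card : (S₀.card : ℝ) ≤ Fintype.card V / 8)
    (hsum : ∑ v, (1 - g v) ≤ Fintype.card V / 16)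
    (hX : ∀ v, X v ≠ 0 → v ∈ W) {A h : ℝ} (hA : 0 < A) (hW : (W.card : ℝ) ≤ A) (hh : 0 ≤ h)
    (hent : Real.logb 2 A - h ≤ entropy X)
    (hsumA : (∑ v, (1 - g v)) * (2 : ℝ) ^ (2 * h + 3) ≤ A) :
    1 / 16 ≤ ∑ v, (X v).toReal * a v - (∑ v, a v) / Fintype.card V := by
  have hmass : ∑ v with g v < 1 / 2, (X v).toReal ≤ 1 / 2 := by
    refine sum_toReal_le_half_of_entropy_ge hX hA hW hh (le_trans ?_ hsumA) hent
    calc _ ≤ (2 * ∑ v, (1 - g v)) * (2 : ℝ) ^ (2 * (h + 1)) := by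
          gcongr
          exact card_filter_lt_half_le hg
      _ = _ := by
          rw [show 2 * h + 3 = 2 * (h + 1) + 1 by ring, Real.rpow_add two_pos, Real.rpow_one]
          ring
  have hunif : (∑ v, a v) / Fintype.card V ≤ 3 / 16 :=
    div_le_of_le_mul₀ (Nat.cast_nonneg _) (by norm_num)
      (by linarith [sum_le_sum_one_sub_add_card ha₁ hg hS₀])
  linarith [quarter_le_sum_mul ha₀ hag hmass]

/-! ### Strings of small complexity -/

section Complexity

variable {k : ℕ} {U : DescriptionSystem k}

theorem DescriptionSystem.Emulates.unique {p : List Bool} {t : ℕ} {x y : List Bool}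
    (hx : U.Emulates p t x) (hy : U.Emulates p t y) : x = y := by
  obtain ⟨M, w, hp, hMx⟩ := hx
  obtain ⟨N, v, hp', hNy⟩ := hy
  obtain ⟨rfl, rfl⟩ := Prod.mk.inj (Option.some.inj (hp.symm.trans hp'))
  exact TM.Outputs.unique hMx hNy

theorem DescriptionSystem.K_le {t : ℕ → ℕ} {p x : List Bool} (h : U.Emulates p (t x.length) x) :
    U.K t x ≤ p.length :=
  Nat.sInf_le ⟨p, rfl, h⟩

theorem card_K_eq_le (U : DescriptionSystem k) (t : ℕ → ℕ) (m l : ℕ) :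
    (Finset.univ.filter fun y : Fin m → Bool => U.K t (List.ofFn y) = l).card ≤ 2 ^ l := by
  choose p hlength hp using fun y : Fin m → Bool => U.K_attained t (List.ofFn y)
  rw [← Fintype.card_coe, show 2 ^ l = Fintype.card (List.Vector Bool l) by simp]
  refine Fintype.card_le_of_injective
    (fun y => ⟨p y, (hlength y).trans (Finset.mem_filter.1 y.2).2⟩) fun y z hyz => ?_
  have hy := hp y
  have hz := hp z
  rw [List.length_ofFn, Subtype.mk.inj hyz] at hy
  rw [List.length_ofFn] at hz
  exact Subtype.ext (List.ofFn_injective (hy.unique hz))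

theorem card_K_lt_le (U : DescriptionSystem k) (t : ℕ → ℕ) (m l : ℕ) :
    (Finset.univ.filter fun y : Fin m → Bool => U.K t (List.ofFn y) < l).card ≤ 2 ^ l := by
  calc _ = ((Finset.range l).biUnion fun i =>
        Finset.univ.filter fun y : Fin m → Bool => U.K t (List.ofFn y) = i).card := by
        congr 1
        ext y
        simp
    _ ≤ ∑ i ∈ Finset.range l, 2 ^ i :=
        Finset.card_biUnion_le.trans (Finset.sum_le_sum fun i _ => card_K_eq_le U t m i)
    _ ≤ 2 ^ l := (Nat.geomSum_lt le_rfl fun i hi => Finset.mem_range.1 hi).le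

end Complexity

section AcceptProb

variable {k k' : ℕ} {D : TM Bool k'} {TD T : Polynomial ℕ} {H : TM Bool k}

theorem IsThresholdTest.acceptProb_eq (hD : IsThresholdTest D TD H T) {n m : ℕ} (hm : m < 2 * n)
    (X : PMF (Fin m → Bool)) : acceptProb D TD n X = ∑ y, (X y).toReal *
      valueProb H (T.eval m) (List.ofFn y) fun v => 2 * v ≤ n + m := by
  refine Finset.sum_congr rfl fun y _ => ?_
  rw [hD n (List.ofFn y) (by simpa using hm), List.length_ofFn]

theorem IsThresholdTest.acceptProb_uniform (hD : IsThresholdTest D TD H T) {n m : ℕ}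
    (hm : m < 2 * n) : acceptProb D TD n (PMF.uniformOfFintype (Fin m → Bool)) =
      (∑ y : Fin m → Bool, valueProb H (T.eval m) (List.ofFn y) fun v => 2 * v ≤ n + m) /
        2 ^ m := by
  rw [hD.acceptProb_eq hm, Finset.sum_div]
  exact Finset.sum_congr rfl fun y _ => by simp [div_eq_inv_mul]

end AcceptProb

theorem sum_one_sub_valueProb_le {k : ℕ} {H : TM Bool k} {T : Polynomial ℕ} {f : List Bool → ℕ}
    {b δ : ℝ} {m : ℕ} (h : 1 - δ ≤ approxProb H T f b m) :
    ∑ y : Fin m → Bool, (1 - valueProb H (T.eval m) (List.ofFn y)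
      fun v => |(v : ℝ) - f (List.ofFn y)| ≤ b) ≤ δ * 2 ^ m := by
  rw [approxProb, le_div_iff₀ (by positivity)] at h
  rw [Finset.sum_sub_distrib]
  simp only [valueProb, Finset.sum_const, Finset.card_univ, Fintype.card_fun, Fintype.card_bool,
    Fintype.card_fin, nsmul_eq_mul]
  push_cast
  linarith

/-- On the support of `X`, where `K ≤ n + c`, an approximation of `K` lies below the threshold
`(n + m) / 2`; on the strings with `K ≥ m - 3` it lies above. -/
theorem sixteenth_le_acceptProb_sub {k kH kD : ℕ} {U : DescriptionSystem k} {t : ℕ → ℕ}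
    {H : TM Bool kH} {T : Polynomial ℕ} {D : TM Bool kD} {TD : Polynomial ℕ}
    (hD : IsThresholdTest D TD H T) {n m c : ℕ} {X : PMF (Fin m → Bool)}
    {W : Finset (Fin m → Bool)} (hm : m < 2 * n) (hc : 4 ≤ c) {b : ℝ} (hb : 0 ≤ b)
    (hcb : 2 * (c + b) ≤ m - n) (hX : ∀ y, X y ≠ 0 → y ∈ W) (hW : W.card ≤ 2 ^ n)
    (hXK : ∀ y, X y ≠ 0 → U.K t (List.ofFn y) ≤ n + c) {δ h : ℝ} (hδ : δ ≤ 1 / 16) (hh : 0 ≤ h)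
    (hδn : δ * 2 ^ m * (2 : ℝ) ^ (2 * h + 3) ≤ 2 ^ n)
    (hH : 1 - δ ≤ approxProb H T (U.K t) b m) (hent : n - h ≤ entropy X) :
    1 / 16 ≤ acceptProb D TD n X - acceptProb D TD n (PMF.uniformOfFintype (Fin m → Bool)) := by
  have hsum := sum_one_sub_valueProb_le hH
  have hcard : (Fintype.card (Fin m → Bool) : ℝ) = 2 ^ m := by simp
  have hc' : (4 : ℝ) ≤ c := mod_cast hc
  rw [hD.acceptProb_eq hm, hD.acceptProb_uniform hm, ← hcard]
  refine sixteenth_le_advantage (A := 2 ^ n)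
    (S₀ := Finset.univ.filter fun y => U.K t (List.ofFn y) < m - 3)
    (fun _ => valueProb_nonneg) (fun _ => valueProb_le_one) (fun _ => valueProb_le_one)
    (fun y hy => valueProb_mono fun v hv => ?_)
    (fun y hy => valueProb_add_le_one fun v hle hv => ?_) ?_ (hsum.trans ?_) hX
    (by positivity) (mod_cast hW) hh
    (hent.trans' (by rw [Real.logb_pow, Real.logb_self_eq_one one_lt_two, mul_one]))
    (hδn.trans' (by gcongr))
  · have hK : (U.K t (List.ofFn y) : ℝ) ≤ n + c := mod_cast hXK y hy
    have : 2 * (v : ℝ) ≤ n + m := by linarith [(abs_le.1 hv).2]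
    exact_mod_cast this
  · have hK : m ≤ U.K t (List.ofFn y) + 3 := by
      simpa only [Finset.mem_filter_univ, not_lt, Nat.sub_le_iff_le_add] using hy
    have hK' : (m : ℝ) ≤ U.K t (List.ofFn y) + 3 := mod_cast hK
    have hle' : 2 * (v : ℝ) ≤ n + m := mod_cast hle
    linarith [(abs_le.1 hv).1]
  · have hm3 : 3 ≤ m := by
      have : (3 : ℝ) ≤ m := by linarith [(n.cast_nonneg : (0 : ℝ) ≤ n)]
      exact_mod_cast this
    have hpow : (2 : ℝ) ^ m = 2 ^ (m - 3) * 8 := by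
      rw [show (8 : ℝ) = 2 ^ 3 by norm_num, ← pow_add, Nat.sub_add_cancel hm3]
    rw [hcard, hpow, mul_div_cancel_right₀ _ (by norm_num)]
    exact_mod_cast card_K_lt_le U t m (m - 3)
  · rw [hcard]
    linarith [mul_le_mul_of_nonneg_right hδ (by positivity : (0 : ℝ) ≤ 2 ^ m)]

/-! ### Asymptotics -/

theorem tendsto_logb_natCast : Filter.Tendsto (fun n : ℕ => Real.logb 2 n) .atTop .atTop :=
  (Real.tendsto_logb_atTop one_lt_two).comp tendsto_natCast_atTop_atTop

theorem eventually_mul_logb_add_le (a b : ℝ) {c : ℝ} (hc : 0 < c) :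
    ∀ᶠ n : ℕ in .atTop, a * Real.logb 2 n + b ≤ c * n := by
  have hlittle : (fun x : ℝ => a * Real.logb 2 x + b) =o[.atTop] (fun x : ℝ => x) :=
    (Real.isLittleO_logb_id_atTop.const_mul_left a).add (Asymptotics.isLittleO_const_id_atTop b)
  filter_upwards [tendsto_natCast_atTop_atTop.eventually (hlittle.bound hc)] with n hn
  rw [Real.norm_eq_abs, Real.norm_eq_abs, Nat.abs_cast] at hn
  exact (le_abs_self _).trans hn

theorem eventually_mul_rpow_le (C : ℝ) {a ε : ℝ} (ha : a < 1) (hε : 0 < ε) :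
    ∀ᶠ n : ℕ in .atTop, C * (n : ℝ) ^ a ≤ ε * n := by
  have hlim : Filter.Tendsto (fun n : ℕ => C * (n : ℝ) ^ (-(1 - a))) .atTop (nhds (C * 0)) :=
    ((tendsto_rpow_neg_atTop (sub_pos.2 ha)).comp tendsto_natCast_atTop_atTop).const_mul C
  rw [mul_zero] at hlim
  filter_upwards [hlim.eventually_le_const hε, Filter.eventually_gt_atTop 0] with n hn hn0
  have hpow : (n : ℝ) ^ a = (n : ℝ) ^ (-(1 - a)) * n := by
    rw [← Real.rpow_add_one (Nat.cast_ne_zero.2 hn0.ne'), neg_sub, sub_add_cancel]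
  rw [hpow, ← mul_assoc]
  gcongr

theorem logb_natCast_le_logb {a b : ℕ} (h : a ≤ b) : Real.logb 2 a ≤ Real.logb 2 b := by
  rcases a.eq_zero_or_pos with rfl | ha
  · rcases b.eq_zero_or_pos with rfl | hb
    · exact le_rfl
    · simpa using Real.logb_nonneg one_lt_two (Nat.one_le_cast.2 hb)
  · exact Real.logb_le_logb_of_le one_lt_two (mod_cast ha) (mod_cast h)

theorem logb_natCast_nonneg (n : ℕ) : 0 ≤ Real.logb 2 n := by
  simpa using logb_natCast_le_logb n.zero_le

theorem le_rpow_mul_of_logb_add_le {s x y : ℝ} (hx : 0 ≤ x) (hy : 0 < y)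
    (h : Real.logb 2 x + s ≤ Real.logb 2 y) : x ≤ 2 ^ (-s) * y := by
  rcases hx.eq_or_lt with rfl | hx
  · positivity
  · rw [← Real.logb_le_logb one_lt_two hx (by positivity), Real.logb_mul (by positivity) hy.ne',
      Real.logb_rpow two_pos (by norm_num)]
    linarith

/-! ### Output lengths -/

theorem exists_outLen_eq_or_gap {γ : ℝ} (hγ : 0 ≤ γ) (m : ℕ) :
    (∃ n, outLen γ n = m) ∨ ∃ n j : ℕ, m = n + j ∧ γ * Real.logb 2 n < j ∧
      j ≤ γ * Real.logb 2 (n + 1 : ℕ) := by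
  classical
  have hex : ∃ n, m < outLen γ n := ⟨m + 1, Nat.lt_succ_self m |>.trans_le (Nat.le_add_right _ _)⟩
  obtain ⟨n, hn⟩ : ∃ n, Nat.find hex = n + 1 :=
    Nat.exists_eq_add_one.2 ((Nat.find_pos hex).2 (by simp [outLen]))
  have hlt : m < outLen γ (n + 1) := hn ▸ Nat.find_spec hex
  have hle : outLen γ n ≤ m := not_lt.1 (Nat.find_min hex (hn ▸ n.lt_succ_self))
  refine hle.eq_or_lt.imp (fun h => ⟨n, h⟩) fun hlt' => ?_
  simp only [outLen] at hlt hlt'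
  refine ⟨n, m - n, by omega, Nat.lt_of_floor_lt (by omega), ?_⟩
  exact (Nat.le_floor_iff (mul_nonneg hγ (logb_natCast_nonneg _))).1 (by omega)

/-- If `m = n + j = n' + j'` falls in a gap for both stretches, then `n ≈ 2 ^ (j / γ)` and
`n' ≈ 2 ^ (j' / 2γ)`, so `n ≈ n'` forces `j' = 2 * j`; but then `j < j'` separates `n` from `n'`. -/
theorem eventually_exists_outLen_eq {γ : ℝ} (hγ : 0 < γ) :
    ∀ᶠ m : ℕ in .atTop, (∃ n, outLen γ n = m) ∨ ∃ n, outLen (2 * γ) n = m := by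
  have hγ2 : 0 < 2 * γ := by positivity
  have hr : (2 : ℝ) ^ (-(1 / (2 * γ))) < 1 :=
    Real.rpow_lt_one_of_one_lt_of_neg one_lt_two (neg_lt_zero.2 (by positivity))
  filter_upwards [(Filter.tendsto_add_atTop_nat 1).eventually
    (eventually_mul_logb_add_le (2 * γ) 2 (sub_pos.2 hr))] with m hlarge
  refine (exists_outLen_eq_or_gap hγ.le m).imp_right fun ⟨n, j, hm, hlo, hhi⟩ =>
    (exists_outLen_eq_or_gap hγ2.le m).resolve_right ?_
  rintro ⟨n', j', hm', hlo', hhi'⟩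
  have hj : (0 : ℝ) < j := hlo.trans_le' (mul_nonneg hγ.le (logb_natCast_nonneg n))
  rcases le_or_gt (2 * j) j' with hle | hlt
  · have hn : n' + 1 ≤ n := by
      have : 0 < j := mod_cast hj
      omega
    have hle' : 2 * (j : ℝ) ≤ j' := mod_cast hle
    have := mul_le_mul_of_nonneg_left (logb_natCast_le_logb hn) hγ2.le
    linarith
  · have hlt' : (j' : ℝ) + 1 ≤ 2 * j := mod_cast hlt
    have hn' : (n' : ℝ) ≤ 2 ^ (-(1 / (2 * γ))) * (n + 1 : ℕ) := by
      refine le_rpow_mul_of_logb_add_le n'.cast_nonneg (by positivity) ?_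
      rw [← mul_le_mul_iff_right₀ hγ2, mul_add, mul_one_div_cancel hγ2.ne']
      linarith
    have hn : (2 : ℝ) ^ (-(1 / (2 * γ))) * (n + 1 : ℕ) ≤
        2 ^ (-(1 / (2 * γ))) * (m + 1 : ℕ) := by
      gcongr
      omega
    have hj' := hhi'.trans (mul_le_mul_of_nonneg_left
      (logb_natCast_le_logb (show n' + 1 ≤ m + 1 by omega)) hγ2.le)
    have hmr : (m : ℝ) = n' + j' := mod_cast hm'
    push_cast at hlarge hn' hn hj'
    linarith

theorem eventually_mem_range_imp {L : ℕ → ℕ} {P : ℕ → Prop} (h : ∀ᶠ n in .atTop, P (L n)) :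
    ∀ᶠ m in .atTop, m ∈ Set.range L → P m := by
  rw [← Nat.cofinite_eq_atTop] at h ⊢
  refine (Set.Finite.image L h).subset ?_
  rintro _ hm
  obtain ⟨⟨n, rfl⟩, hn⟩ := Classical.not_imp.1 hm
  exact ⟨n, hn, rfl⟩

theorem eventually_outLen_lt_two_mul {γ : ℝ} (hγ : 0 ≤ γ) :
    ∀ᶠ n : ℕ in .atTop, outLen γ n < 2 * n := by
  filter_upwards [eventually_mul_logb_add_le γ 1 one_pos] with n hn
  have hfloor : ⌊γ * Real.logb 2 n⌋₊ < n :=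
    (Nat.floor_lt (mul_nonneg hγ (logb_natCast_nonneg n))).2 (by linarith)
  rw [outLen, two_mul]
  gcongr

theorem eventually_le_outLen_sub {d γ : ℝ} (hd : 0 ≤ d) (hγ : 4 * d + 2 ≤ γ) (c : ℝ) :
    ∀ᶠ n : ℕ in .atTop, 2 * (c + d * Real.logb 2 (outLen γ n)) ≤ outLen γ n - n := by
  filter_upwards [eventually_outLen_lt_two_mul (by linarith : 0 ≤ γ),
    tendsto_logb_natCast.eventually_ge_atTop (c + d + 1), Filter.eventually_gt_atTop 0]
    with n hlt hlog hn
  have hlogm : Real.logb 2 (outLen γ n) ≤ 1 + Real.logb 2 n := by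
    have := logb_natCast_le_logb hlt.le
    rwa [Nat.cast_mul, Nat.cast_ofNat, Real.logb_mul two_ne_zero (Nat.cast_ne_zero.2 hn.ne'),
      Real.logb_self_eq_one one_lt_two] at this
  have hfloor := Nat.lt_floor_add_one (γ * Real.logb 2 n)
  have hdlog := mul_le_mul_of_nonneg_left hlogm hd
  have hγlog := mul_le_mul_of_nonneg_right hγ (logb_natCast_nonneg n)
  have hdn := mul_nonneg hd (logb_natCast_nonneg n)
  have hm : (outLen γ n : ℝ) = n + ⌊γ * Real.logb 2 n⌋₊ := Nat.cast_add _ _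
  linarith

theorem one_div_outLen_add_one_pow_le {γ : ℝ} {n e : ℕ} (he : e ≠ 0) (hn : 0 < n) :
    1 / ((outLen γ n : ℝ) + 1) ^ e ≤ 1 / n := by
  have hle : n ≤ outLen γ n + 1 := (Nat.le_add_right _ _).trans (Nat.le_succ _)
  refine one_div_le_one_div_of_le (mod_cast hn) ?_
  exact_mod_cast hle.trans (Nat.le_self_pow he _)

theorem one_div_mul_two_pow_outLen_le {γ s : ℝ} {n e : ℕ} (hγ : 0 ≤ γ) (hn : 2 ≤ n)
    (he : γ + 2 * s + 3 ≤ e) :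
    1 / ((outLen γ n : ℝ) + 1) ^ e * 2 ^ outLen γ n *
      (2 : ℝ) ^ (2 * (s * Real.logb 2 n) + 3) ≤ 2 ^ n := by
  have hn0 : (0 : ℝ) < n := by positivity
  have hlog : 1 ≤ Real.logb 2 n := by
    simpa only [Nat.cast_ofNat, Real.logb_self_eq_one one_lt_two] using logb_natCast_le_logb hn
  have hpow : (2 : ℝ) ^ (e * Real.logb 2 n) = (n : ℝ) ^ e := by
    rw [mul_comm, Real.rpow_mul two_pos.le, Real.rpow_logb two_pos (by norm_num) hn0,
      Real.rpow_natCast]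
  have hnm : (n : ℝ) ≤ outLen γ n + 1 := mod_cast (Nat.le_add_right _ _).trans (Nat.le_succ _)
  rw [one_div, inv_mul_eq_div, div_mul_eq_mul_div, div_le_iff₀ (by positivity)]
  calc (2 : ℝ) ^ outLen γ n * 2 ^ (2 * (s * Real.logb 2 n) + 3)
      = 2 ^ n * 2 ^ (⌊γ * Real.logb 2 n⌋₊ + (2 * (s * Real.logb 2 n) + 3)) := by
        rw [outLen, pow_add, mul_assoc, Real.rpow_add two_pos ⌊γ * Real.logb 2 n⌋₊,
          Real.rpow_natCast]
    _ ≤ 2 ^ n * 2 ^ (e * Real.logb 2 n) := by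
        have hfloor := Nat.floor_le (mul_nonneg hγ (logb_natCast_nonneg n))
        have := mul_le_mul_of_nonneg_right he (logb_natCast_nonneg n)
        gcongr
        · norm_num
        · linarith
    _ ≤ 2 ^ n * ((outLen γ n : ℝ) + 1) ^ e := by
        rw [hpow]
        gcongr

/-! ### From generators to hardness -/

theorem RateOneEfficient.eventually_K_le {k : ℕ} {m : ℕ → ℕ}
    {G : (n : ℕ) → (Fin n → Bool) → (Fin (m n) → Bool)} (hG : RateOneEfficient k G)
    (U : DescriptionSystem k) (hm : ∀ n, n ≤ m n) {ε : ℝ} (hε : 0 < ε) {t : ℕ → ℕ}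
    (ht : ∀ n : ℕ, ⌊(1 + ε) * n⌋₊ ≤ t n) :
    ∃ c : ℕ, ∀ᶠ n in .atTop, ∀ s, U.K t (List.ofFn (G n s)) ≤ n + c := by
  obtain ⟨M, T, hM, C, a, ha, hT⟩ := hG
  obtain ⟨c, hc⟩ := U.universal M
  refine ⟨c, ?_⟩
  filter_upwards [eventually_mul_rpow_le C ha hε, Filter.eventually_ge_atTop 1] with n hrate hn s
  obtain ⟨p, hdecode, hlength⟩ := hc (List.ofFn s)
  have htime : T n ≤ t (m n) := by
    refine (Nat.le_floor ?_).trans (ht (m n))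
    have hnm : (n : ℝ) ≤ m n := mod_cast hm n
    nlinarith [hT n hn]
  have hemulates : U.Emulates p (t (List.ofFn (G n s)).length) (List.ofFn (G n s)) :=
    ⟨M, List.ofFn s, hdecode, (hM n s).mono (by rwa [List.length_ofFn])⟩
  simpa only [List.length_ofFn] using (DescriptionSystem.K_le hemulates).trans hlength

theorem eventually_approxProb_outLen_lt {k : ℕ} (U : DescriptionSystem k) {μ : ℕ → ℝ}
    (hμ : ∀ᶠ n in .atTop, μ n ≤ 1 / 16) {d ε γ : ℝ} (hd : 0 ≤ d) (hε : 0 < ε)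
    (hγ : 4 * d + 2 ≤ γ) {t : ℕ → ℕ} (ht : ∀ n : ℕ, ⌊(1 + ε) * n⌋₊ ≤ t n)
    {G : (n : ℕ) → (Fin n → Bool) → (Fin (outLen γ n) → Bool)} (hG : RateOneEfficient k G)
    (hsecure : IsCondEPPRG μ γ G) :
    ∃ e₀ : ℕ, ∀ e ≥ e₀, ∀ (kH : ℕ) (H : TM Bool kH) (T : Polynomial ℕ), RunsInTime H T →
      ∀ᶠ n in .atTop, approxProb H T (U.K t) (d * Real.logb 2 (outLen γ n)) (outLen γ n) <
        1 - 1 / ((outLen γ n : ℝ) + 1) ^ e := by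
  obtain ⟨-, E, hE, α, hind, hent⟩ := hsecure
  obtain ⟨c, hK⟩ := hG.eventually_K_le U (m := outLen γ) (fun n => Nat.le_add_right _ _) hε ht
  obtain ⟨e₀, he₀⟩ := exists_nat_ge (γ + 2 * |α| + 3)
  have hγ0 : 0 ≤ γ := by linarith
  refine ⟨e₀, fun e he kH H T hT => ?_⟩
  obtain ⟨kD, D, TD, hDtime, hD⟩ := exists_isThresholdTest H T hT
  have he' : γ + 2 * |α| + 3 ≤ e := he₀.trans (mod_cast he)
  have he0 : e ≠ 0 := by
    rintro rfl
    rw [Nat.cast_zero] at he'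
    linarith [abs_nonneg α]
  filter_upwards [hK, Filter.eventually_atTop.2 hent,
    Filter.eventually_atTop.2 (hind kD D TD hDtime), hμ, eventually_outLen_lt_two_mul hγ0,
    eventually_le_outLen_sub hd hγ (c + 4 : ℕ), Filter.eventually_ge_atTop 16]
    with n hKn hentn hindn hμn hlt hgap hn
  by_contra! happrox
  have himage : ∀ y, (PMF.uniformOfFinset (E n) (hE n)).map (G n) y ≠ 0 → ∃ s, G n s = y :=
    fun y hy => ((PMF.mem_support_map_iff _ _ _).1 ((PMF.mem_support_iff _ _).2 hy)).imp
      fun _ h => h.2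
  have hadvantage := sixteenth_le_acceptProb_sub hD (W := Finset.univ.image (G n)) hlt
    (Nat.le_add_left 4 c) (mul_nonneg hd (logb_natCast_nonneg _)) hgap
    (fun y hy => by simpa using himage y hy)
    (Finset.card_image_le.trans (by simp))
    (fun y hy => by
      obtain ⟨s, rfl⟩ := himage y hy
      exact (hKn s).trans (by omega))
    ((one_div_outLen_add_one_pow_le he0 (by omega)).trans
      (one_div_le_one_div_of_le (by norm_num) (mod_cast hn)))
    (mul_nonneg (abs_nonneg α) (logb_natCast_nonneg n))
    (one_div_mul_two_pow_outLen_le hγ0 (by omega) he') happrox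
    (hentn.trans' (sub_le_sub_left
      (mul_le_mul_of_nonneg_right (le_abs_self α) (logb_natCast_nonneg n)) _))
  linarith [le_abs_self (acceptProb D TD n ((PMF.uniformOfFinset (E n) (hE n)).map (G n)) -
    acceptProb D TD n (PMF.uniformOfFintype (Fin (outLen γ n) → Bool)))]

theorem mainTheorem3_general {k : ℕ} (U : DescriptionSystem k) {μ : ℕ → ℝ}
    (hμ : ∀ᶠ n in .atTop, μ n ≤ 1 / 16) {d ε γ : ℝ} (hd : 0 ≤ d) (hε : 0 < ε)
    (hγ : 4 * d + 2 ≤ γ)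
    (hG : ∃ G : (n : ℕ) → (Fin n → Bool) → (Fin (outLen γ n) → Bool),
      RateOneEfficient k G ∧ IsCondEPPRG μ γ G)
    (hG' : ∃ G : (n : ℕ) → (Fin n → Bool) → (Fin (outLen (2 * γ) n) → Bool),
      RateOneEfficient k G ∧ IsCondEPPRG μ (2 * γ) G)
    {t : ℕ → ℕ} (ht : ∀ n : ℕ, ⌊(1 + ε) * n⌋₊ ≤ t n) :
    MildlyHoAToApprox (U.K t) fun n => d * Real.logb 2 n := by
  obtain ⟨G, hrate, hsecure⟩ := hG
  obtain ⟨G', hrate', hsecure'⟩ := hG'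
  obtain ⟨e, he⟩ := eventually_approxProb_outLen_lt U hμ hd hε hγ ht hrate hsecure
  obtain ⟨e', he'⟩ :=
    eventually_approxProb_outLen_lt U hμ hd hε (by linarith) ht hrate' hsecure'
  refine ⟨(Polynomial.X + 1) ^ max e e', fun n => ?_, fun kH H T hT => ?_⟩
  · simp only [Polynomial.eval_pow, Polynomial.eval_add, Polynomial.eval_X, Polynomial.eval_one]
    positivity
  let Fails : ℕ → Prop := fun m =>
    approxProb H T (U.K t) (d * Real.logb 2 m) m < 1 - 1 / ((m : ℝ) + 1) ^ max e e'
  have hfails := eventually_mem_range_imp (P := Fails) (he _ (le_max_left e e') kH H T hT)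
  have hfails' := eventually_mem_range_imp (P := Fails) (he' _ (le_max_right e e') kH H T hT)
  rw [← Filter.eventually_atTop]
  filter_upwards [eventually_exists_outLen_eq (by linarith : 0 < γ), hfails, hfails']
    with m hm hfails hfails'
  simpa only [Polynomial.eval_pow, Polynomial.eval_add, Polynomial.eval_X, Polynomial.eval_one]
    using hm.elim hfails hfails'

end CondEP

theorem mainTheorem3 (k : ℕ) (U : CondEP.DescriptionSystem k)
    (hG : ∀ γ : ℚ, 1 < γ →
      ∃ G : (n : ℕ) → (Fin n → Bool) → (Fin (CondEP.outLen (γ : ℝ) n) → Bool),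
        CondEP.RateOneEfficient k G ∧
        CondEP.IsCondEPPRG (fun n => 1 / (n : ℝ) ^ 2) (γ : ℝ) G)
    (d ε : ℝ) (hd : 0 < d) (hε : 0 < ε)
    (t : Polynomial ℝ) (ht : ∀ n : ℕ, (1 + ε) * (n : ℝ) ≤ t.eval (n : ℝ)) :
    CondEP.MildlyHoAToApprox (U.K (fun n => ⌊t.eval (n : ℝ)⌋₊))
      (fun n => d * Real.logb 2 n) := by
  obtain ⟨γ, hγ⟩ := exists_rat_gt (4 * d + 2)
  have hγ1 : 1 < γ := by exact_mod_cast (by linarith : (1 : ℝ) < γ)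
  have hμ : ∀ᶠ n : ℕ in .atTop, 1 / (n : ℝ) ^ 2 ≤ 1 / 16 := by
    filter_upwards [Filter.eventually_ge_atTop 4] with n hn
    exact one_div_le_one_div_of_le (by norm_num) (by exact_mod_cast Nat.pow_le_pow_left hn 2)
  have hG' := hG (2 * γ) (by linarith)
  rw [Rat.cast_mul, Rat.cast_ofNat] at hG'
  exact CondEP.mainTheorem3_general U hμ hd.le hε hγ.le (hG γ hγ1) hG'
    fun n => Nat.floor_le_floor (ht n)
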